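/- Let $G$ be a finite simple plane graph (a finite simple graph drawn in the plane without crossings, not necessarily connected) whose minimum degree is exactly $5$ and which has no vertices of degree $7$, $8$ or $9$. For $\kappa_1,\dots,\kappa_5\in\mathbb{N}\cup\{\infty\}$, a $\langle \kappa_1,\kappa_2,\kappa_3,\kappa_4,\kappa_5\rangle$-star in $G$ is a star consisting of a vertex $v$ of degree $5$ and its five neighbors $v_1,v_2,v_3,v_4,v_5$, listed in a cyclic order (clockwise or counterclockwise, with any starting point) in which they appear around $v$ in the drawing, such that $\deg_G(v_i)\le\kappa_i$ for $i=1,\dots,5$. Then $G$ contains at least one of the following: a $\langle 5,6,6,5,\infty\rangle$-star, a $\langle 5,6,6,6,17\rangle$-star, a $\langle 6,6,6,6,11\rangle$-star, or a $\langle 5,5,10,5,12\rangle$-star. -/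

import Mathlib

/-- An embedding of a graph in an oriented surface, up to homeomorphism, given by its rotation
system: at every vertex, the darts (oriented edges) leaving it are arranged in one cyclic order,
and `next d` is the dart that follows `d` in that order around its initial vertex `d.fst`. -/
structure RotationSystem {V : Type*} (G : SimpleGraph V) where
  /-- the successor of a dart in the cyclic order around its initial vertex -/
  next : Equiv.Perm G.Dart
  /-- the successor leaves the same vertex -/
  fst_next : ∀ d : G.Dart, (next d).fst = d.fst
  /-- all the darts leaving a vertex form a single cycle -/
  sameCycle : ∀ d d' : G.Dart, d.fst = d'.fst → next.SameCycle d d'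

namespace RotationSystem

/-- Reversal of darts, as a permutation. -/
def reverse {V : Type*} (G : SimpleGraph V) : Equiv.Perm G.Dart :=
  (SimpleGraph.Dart.symm_involutive (G := G)).toPerm

/-- The face permutation: walk along a dart, and at its end continue with the next dart. -/
def facePerm {V : Type*} {G : SimpleGraph V} (R : RotationSystem G) : Equiv.Perm G.Dart :=
  (reverse G).trans R.next

/-- The facial walks that contain an edge: the orbits of the face permutation. -/
def Face {V : Type*} {G : SimpleGraph V} (R : RotationSystem G) : Type _ :=
  Quotient (Equiv.Perm.SameCycle.setoid R.facePerm)

/-- The number of facial walks. A component that is a single isolated vertex has no darts; it has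
one facial walk, of length zero. -/
noncomputable def numFaces {V : Type*} {G : SimpleGraph V} (R : RotationSystem G) : ℕ :=
  Nat.card R.Face + Nat.card {v : V // G.IsIsolated v}

/-- Twice the genus of the embedding. Every component `C` of the graph is embedded in a closed
oriented surface, whose genus `g` is defined by `2 - 2 * g = |V C| - |E C| + |F C|`; the genus of
the embedding is the sum of these non-negative integers. -/
noncomputable def twiceGenus {V : Type*} {G : SimpleGraph V} (R : RotationSystem G) : ℤ :=
  2 * (Nat.card G.ConnectedComponent : ℤ)
    - ((Nat.card V : ℤ) - (Nat.card G.edgeSet : ℤ) + (R.numFaces : ℤ))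

/-- The rotation system of a plane graph: every component is embedded in the sphere, that is, in
the closed oriented surface of genus zero. -/
def IsPlane {V : Type*} {G : SimpleGraph V} (R : RotationSystem G) : Prop :=
  R.twiceGenus = 0

/-- There is a `⟨κ 0, κ 1, κ 2, κ 3, κ 4⟩`-star: a vertex of degree five whose neighbors, in a
cyclic order around it (in either of the two directions, and starting anywhere), have degrees at
most `κ 0`, …, `κ 4`. -/
def HasStar {V : Type*} {G : SimpleGraph V} [G.LocallyFinite] (R : RotationSystem G)
    (κ : Fin 5 → ℕ∞) : Prop :=
  ∃ d : G.Dart, G.degree d.fst = 5 ∧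
    ((∀ i : Fin 5, (G.degree ((R.next ^ (i : ℕ)) d).snd : ℕ∞) ≤ κ i) ∨
      (∀ i : Fin 5, (G.degree ((R.next⁻¹ ^ (i : ℕ)) d).snd : ℕ∞) ≤ κ i))

end RotationSystem

/-! The proof is by discharging. A vertex gets the charge `deg - 6` and a face of length `ℓ` the
charge `2ℓ - 6`; by Euler's formula the total is negative. A face with `ℓ ≥ 4` can afford 1/2 for
each of its corners, so a vertex may use `deg - 6` plus 1/2 per non-triangular corner. Only vertices
of degree 5 are then short: by 1 if all their corners are triangular (`AllTri`), by at most 1/2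
otherwise. Since degrees 7, 8, 9 do not occur, the payers are the vertices of degree `n ≥ 10`, and
`pay` is what they send to neighbors of degree 5.

In the basic rule each corner of the payer spends `(n - 6)/n` on its neighbors of degree 5, halved
if both sides have degree 5 (`share`). If a receiver has a single large neighbor, the first three
stars force that neighbor to have degree at least 18 (one side of degree 5) or 12 (no side of degree
5), and it pays 1 alone. If there are several, two of them must pay 1 together.

Degrees 11 and 13 have their own rules, because 1/2 or 11/20 per neighbor slightly exceeds the
budget. The excess is saved at a neighbor of degree other than 5, at a non-triangular corner, or, at
a `Tight` vertex, by a parity argument (`Tight.exists_saving`). A vertex of degree 10 may pay only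
2/5; the deficit is covered by a boost at degree 11 or by shifts (`give`) between consecutive
receivers, and the fourth star guarantees that one of these is available
(`one_le_pay_add_pay_eleven`, `one_le_pay_add_pay_ten`).

Payers stay non-negative by `sum_base_le`, receivers by `one_le_sum_pay` and `half_le_sum_pay`;
`not_starless` draws the contradiction. -/

namespace RotationSystem

open Finset

/-! ### Mirror images and triangular corners. -/

section Mirror

variable {V : Type*} {G : SimpleGraph V}

/-- The same drawing seen from the other side: every rotation is reversed. -/
def mirror (R : RotationSystem G) : RotationSystem G where
  next := R.next⁻¹
  fst_next d := by
    have h := R.fst_next (R.next⁻¹ d)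
    simpa using h.symm
  sameCycle d d' h := (R.sameCycle d d' h).inv

@[simp] theorem mirror_mirror (R : RotationSystem G) : R.mirror.mirror = R := by
  cases R
  simp [mirror]

@[simp] theorem next_mirror_next (R : RotationSystem G) (d : G.Dart) :
    R.next (R.mirror.next d) = d := by
  simp [mirror]

@[simp] theorem mirror_next_next (R : RotationSystem G) (d : G.Dart) :
    R.mirror.next (R.next d) = d := by
  simp [mirror]

@[simp] theorem next_fst (R : RotationSystem G) (d : G.Dart) : (R.next d).fst = d.fst :=
  R.fst_next d

/-- The corner between a dart and its predecessor lies in a triangular face. -/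
def IsTri (R : RotationSystem G) (d : G.Dart) : Prop :=
  R.next (R.next (R.next d.symm).symm).symm = d

/-- In the mirror image the predecessor of a dart is its successor, so the corner being tested is
the one after `d`. -/
theorem mirror_isTri (R : RotationSystem G) (d : G.Dart) :
    R.mirror.IsTri d ↔ R.IsTri (R.next d) := by
  unfold IsTri
  rw [EmbeddingLike.apply_eq_iff_eq]
  constructor
  · intro h
    have h1 := congrArg (fun x => R.next x) h
    simp only [next_mirror_next] at h1
    rw [← h1]; simp
  · intro h
    have h1 : d.symm = R.next (R.next (R.next d).symm).symm := by
      simpa using (congrArg SimpleGraph.Dart.symm h).symm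
    have h2 : R.mirror.next d.symm = (R.next (R.next d).symm).symm := by
      conv_lhs => rw [h1]
      simp
    rw [h2]; simp

/-- `IsTri` says that the cube of `facePerm` fixes the dart, which is constant along a facial walk.
-/
theorem isTri_next_symm (R : RotationSystem G) (d : G.Dart) :
    R.IsTri (R.next d.symm) ↔ R.IsTri d := by
  unfold IsTri
  rw [EmbeddingLike.apply_eq_iff_eq]
  constructor
  · intro h
    have := congrArg SimpleGraph.Dart.symm h
    simpa using this
  · intro h
    rw [h]

theorem mirror_isTri_symm (R : RotationSystem G) (d : G.Dart) :
    R.mirror.IsTri d.symm ↔ R.IsTri d := by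
  rw [mirror_isTri, isTri_next_symm]

theorem isTri_symm (R : RotationSystem G) (d : G.Dart) :
    R.IsTri d.symm ↔ R.mirror.IsTri d := by
  simpa using R.mirror.mirror_isTri_symm d

theorem mirror_isTri_mirror_next (R : RotationSystem G) (d : G.Dart) :
    R.mirror.IsTri (R.mirror.next d) ↔ R.IsTri d := by
  simp [mirror_isTri]

/-- Both ways around a triangle reach its third edge. This and its variants identify darts at
neighboring vertices. -/
theorem IsTri.mirror_next_symm {R : RotationSystem G} {d : G.Dart} (h : R.IsTri d) :
    R.mirror.next (R.mirror.next d).symm = (R.next d.symm).symm := by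
  unfold IsTri at h
  have h1 : R.mirror.next d = (R.next (R.next d.symm).symm).symm := by
    conv_lhs => rw [← h]
    simp
  rw [h1]; simp

theorem IsTri.snd_next_symm {R : RotationSystem G} {d : G.Dart} (h : R.IsTri d) :
    (R.next d.symm).snd = (R.mirror.next d).snd := by
  have := congrArg (fun x => x.fst) h.mirror_next_symm
  simpa using this.symm

theorem IsTri.next_symm {R : RotationSystem G} {d : G.Dart} (h : R.IsTri d) :
    R.next d.symm = (R.mirror.next (R.mirror.next d).symm).symm := by
  rw [h.mirror_next_symm]; simp

theorem IsTri.mirror_next_symm_of_mirror {R : RotationSystem G} {d : G.Dart}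
    (h : R.mirror.IsTri d) :
    R.mirror.next d.symm = (R.next (R.next d).symm).symm := by
  simpa using h.next_symm

theorem IsTri.snd_mirror_next_symm {R : RotationSystem G} {d : G.Dart} (h : R.mirror.IsTri d) :
    (R.mirror.next d.symm).snd = (R.next d).snd := by
  simpa using h.snd_next_symm

open Classical in
/-- The part of the charge of a face that a corner may spend. -/
noncomputable def cornerCharge (R : RotationSystem G) (d : G.Dart) : ℚ :=
  if R.IsTri d then 0 else 1 / 2

theorem cornerCharge_nonneg (R : RotationSystem G) (d : G.Dart) : 0 ≤ R.cornerCharge d := by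
  unfold cornerCharge; split_ifs <;> norm_num

theorem facePerm_apply (R : RotationSystem G) (d : G.Dart) : R.facePerm d = R.next d.symm := rfl

theorem facePerm_ne (R : RotationSystem G) (d : G.Dart) : R.facePerm d ≠ d := by
  intro h
  have := congrArg (fun x => x.fst) h
  simp only [facePerm_apply, next_fst] at this
  exact G.ne_of_adj d.adj this.symm

end Mirror

/-! ### Euler's formula as a negative total charge. -/

section Degree

variable {V : Type*} [Fintype V] {G : SimpleGraph V} [DecidableRel G.Adj]

open Classical in
/-- The darts leaving a vertex. -/
noncomputable def out (G : SimpleGraph V) [DecidableRel G.Adj] (v : V) : Finset G.Dart :=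
  {d : G.Dart | d.fst = v}

theorem mem_out {v : V} {d : G.Dart} : d ∈ out G v ↔ d.fst = v := by
  simp [out]

theorem card_out (v : V) : #(out G v) = G.degree v := by
  classical
  rw [← G.dart_fst_fiber_card_eq_degree v]
  unfold out
  congr

theorem isCycleOn_out (R : RotationSystem G) (v : V) : R.next.IsCycleOn (out G v : Set G.Dart) := by
  refine ⟨⟨?_, R.next.injective.injOn, ?_⟩, ?_⟩
  · intro d hd
    simpa [mem_out] using hd
  · intro d hd
    refine ⟨R.mirror.next d, ?_, by simp⟩
    simpa [mem_out] using hd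
  · intro d hd d' hd'
    apply R.sameCycle
    simp only [mem_coe, mem_out] at hd hd'
    rw [hd, hd']

@[simp] theorem degree_next_fst (R : RotationSystem G) (d : G.Dart) :
    G.degree (R.next d).fst = G.degree d.fst := by
  rw [next_fst]

theorem iterate_next_eq_self (R : RotationSystem G) (d : G.Dart) (n : ℕ) :
    (R.next ^ n) d = d ↔ G.degree d.fst ∣ n := by
  rw [(R.isCycleOn_out d.fst).pow_apply_eq (mem_out.2 rfl), card_out]

theorem sum_out_next (R : RotationSystem G) (v : V) (f : G.Dart → ℚ) :
    ∑ d ∈ out G v, f (R.next d) = ∑ d ∈ out G v, f d := by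
  refine sum_bij' (fun d _ => R.next d) (fun d _ => R.mirror.next d) ?_ ?_ ?_ ?_ ?_ <;>
    simp [mem_out]

/-- The degree of the end of a dart. -/
noncomputable def sdeg (d : G.Dart) : ℕ := G.degree d.snd

/-- In a simple graph a facial walk of length two would traverse one edge both ways, making its end
a vertex of degree one. -/
theorem facePerm_facePerm_ne (R : RotationSystem G) (d : G.Dart) (hd : ∀ v, 5 ≤ G.degree v) :
    R.facePerm (R.facePerm d) ≠ d := by
  intro h
  have h1 : (R.facePerm d).fst = d.snd := by simp [facePerm_apply]
  have h2 : (R.facePerm d).snd = d.fst := by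
    have := congrArg (fun x => x.fst) h
    simpa [facePerm_apply] using this
  have h3 : R.facePerm d = d.symm := by
    ext
    · simpa using h1
    · simpa using h2
  have h4 := (R.iterate_next_eq_self d.symm 1).1 (by simpa [facePerm_apply] using h3)
  have := hd d.symm.fst
  have := Nat.le_of_dvd one_pos h4
  omega

/-- A triangle contributes `3 * 2`; a longer face has at least four darts, each contributing `3/2`.
Thus a face still has non-negative charge `2ℓ - 6` after paying its corners. -/
theorem one_le_sum_face (R : RotationSystem G) (hd : ∀ v, 5 ≤ G.degree v) (s : Finset G.Dart)
    (hs : ∀ d ∈ s, R.facePerm d ∈ s) (d : G.Dart) (hds : d ∈ s) :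
    (6 : ℚ) ≤ ∑ e ∈ s, (2 - R.cornerCharge e) := by
  classical
  have hpos : ∀ e ∈ s, 0 ≤ 2 - R.cornerCharge e := by
    intro e _
    unfold cornerCharge
    split_ifs <;> norm_num
  have h1 := R.facePerm_ne d
  have h1' := R.facePerm_ne (R.facePerm d)
  have h1'' := R.facePerm_ne (R.facePerm (R.facePerm d))
  have h2 := R.facePerm_facePerm_ne d hd
  have h2' := R.facePerm_facePerm_ne (R.facePerm d) hd
  by_cases ht : R.IsTri d
  · have hsub : ({d, R.facePerm d, R.facePerm (R.facePerm d)} : Finset G.Dart) ⊆ s := by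
      intro e he
      simp only [mem_insert, mem_singleton] at he
      rcases he with rfl | rfl | rfl
      exacts [hds, hs _ hds, hs _ (hs _ hds)]
    refine le_trans ?_ (sum_le_sum_of_subset_of_nonneg hsub fun e he _ => hpos e he)
    have t1 : R.IsTri (R.facePerm d) := (R.isTri_next_symm d).2 ht
    have t2 : R.IsTri (R.facePerm (R.facePerm d)) := (R.isTri_next_symm _).2 t1
    rw [sum_insert (by simp [h1.symm, h2.symm]), sum_insert (by simp [h1'.symm]), sum_singleton]
    simp only [cornerCharge, if_pos, ht, t1, t2]
    norm_num
  · have h3 : R.facePerm (R.facePerm (R.facePerm d)) ≠ d := ht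
    have hsub : ({d, R.facePerm d, R.facePerm (R.facePerm d),
        R.facePerm (R.facePerm (R.facePerm d))} : Finset G.Dart) ⊆ s := by
      intro e he
      simp only [mem_insert, mem_singleton] at he
      rcases he with rfl | rfl | rfl | rfl
      exacts [hds, hs _ hds, hs _ (hs _ hds), hs _ (hs _ (hs _ hds))]
    refine le_trans ?_ (sum_le_sum_of_subset_of_nonneg hsub fun e he _ => hpos e he)
    have t1 : ¬ R.IsTri (R.facePerm d) := fun h => ht ((R.isTri_next_symm d).1 h)
    have t2 : ¬ R.IsTri (R.facePerm (R.facePerm d)) := fun h => t1 ((R.isTri_next_symm _).1 h)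
    have t3 : ¬ R.IsTri (R.facePerm (R.facePerm (R.facePerm d))) :=
      fun h => t2 ((R.isTri_next_symm _).1 h)
    rw [sum_insert (by simp [h1.symm, h2.symm, h3.symm]),
      sum_insert (by simp [h1'.symm, h2'.symm]), sum_insert (by simp [h1''.symm]), sum_singleton]
    simp only [cornerCharge, if_neg, ht, t1, t2, t3, not_false_eq_true]
    norm_num

theorem six_mul_card_face_le (R : RotationSystem G) (hd : ∀ v, 5 ≤ G.degree v) :
    6 * (Nat.card R.Face : ℚ) ≤ ∑ d : G.Dart, (2 - R.cornerCharge d) := by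
  classical
  have : Finite R.Face := by unfold Face; infer_instance
  have := Fintype.ofFinite R.Face
  let q : G.Dart → R.Face := fun d => Quotient.mk (Equiv.Perm.SameCycle.setoid R.facePerm) d
  rw [← sum_fiberwise univ q, Nat.card_eq_fintype_card]
  calc 6 * (Fintype.card R.Face : ℚ) = ∑ _f : R.Face, (6 : ℚ) := by simp [mul_comm]
    _ ≤ _ := by
      refine sum_le_sum fun f _ => ?_
      obtain ⟨d, rfl⟩ : ∃ d, q d = f := Quotient.exists_rep f
      refine R.one_le_sum_face hd _ ?_ d (by simp)
      intro e he
      simp only [mem_filter, mem_univ, true_and] at he ⊢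
      rw [← he]
      refine Quotient.sound (s := Equiv.Perm.SameCycle.setoid R.facePerm) ?_
      exact Equiv.Perm.SameCycle.symm ⟨1, by simp⟩

/-- Euler's formula: the total charge of vertices and faces is negative. -/
theorem sum_charge_neg (R : RotationSystem G) (hplane : R.IsPlane) (hd : ∀ v, 5 ≤ G.degree v)
    [Nonempty V] :
    ∑ v : V, ((G.degree v : ℚ) - 6) + ∑ d : G.Dart, R.cornerCharge d < 0 := by
  classical
  have hiso : Nat.card {v : V // G.IsIsolated v} = 0 := by
    have : IsEmpty {v : V // G.IsIsolated v} := by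
      refine ⟨fun ⟨v, hv⟩ => ?_⟩
      have h := hd v
      have : G.degree v = 0 := by
        rw [SimpleGraph.degree_eq_zero]
        exact hv
      omega
    simp
  have hf := R.six_mul_card_face_le hd
  unfold IsPlane twiceGenus numFaces at hplane
  rw [hiso] at hplane
  have hC : 1 ≤ Nat.card G.ConnectedComponent := by
    have : Nonempty G.ConnectedComponent := ⟨G.connectedComponentMk (Classical.arbitrary V)⟩
    exact Nat.card_pos
  have hE : (Nat.card G.edgeSet) = #G.edgeFinset := by
    rw [Nat.card_eq_fintype_card, SimpleGraph.edgeFinset_card]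
  rw [hE, Nat.card_eq_fintype_card (α := V)] at hplane
  have hdart : (Fintype.card G.Dart : ℚ) = 2 * (#G.edgeFinset : ℚ) := by
    exact_mod_cast G.dart_card_eq_twice_card_edges
  have hsum : ∑ v : V, (G.degree v : ℚ) = 2 * (#G.edgeFinset : ℚ) := by
    exact_mod_cast G.sum_degrees_eq_twice_card_edges
  rw [sum_sub_distrib, sum_const, card_univ, nsmul_eq_mul, hdart] at hf
  rw [sum_sub_distrib, hsum, sum_const, card_univ, nsmul_eq_mul]
  have hp : (2 * (Nat.card G.ConnectedComponent : ℚ)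
    - ((Fintype.card V : ℚ) - (#G.edgeFinset : ℚ) + ((Nat.card R.Face : ℚ) + 0))) = 0 := by
    exact_mod_cast hplane
  have hC' : (1 : ℚ) ≤ Nat.card G.ConnectedComponent := by exact_mod_cast hC
  linarith

end Degree

/-! ### The discharging rules. -/

section AllTri

variable {V : Type*} {G : SimpleGraph V}

/-- All corners of a vertex lie in triangular faces. -/
def AllTri (R : RotationSystem G) (v : V) : Prop :=
  ∀ d : G.Dart, d.fst = v → R.IsTri d ∧ R.mirror.IsTri d

theorem allTri_mirror (R : RotationSystem G) (v : V) : R.mirror.AllTri v ↔ R.AllTri v := by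
  simp [AllTri, and_comm]

end AllTri

section Payments

variable {V : Type*} [Fintype V] {G : SimpleGraph V} [DecidableRel G.Adj]

/-- All neighbors of a vertex have degree five, and all its corners lie in triangular faces. -/
def Tight (R : RotationSystem G) (v : V) : Prop :=
  ∀ d : G.Dart, d.fst = v → sdeg d = 5 ∧ R.IsTri d ∧ R.mirror.IsTri d

theorem tight_mirror (R : RotationSystem G) (v : V) : R.mirror.Tight v ↔ R.Tight v := by
  simp only [Tight, mirror_mirror, and_comm (a := R.mirror.IsTri _)]

/-- The two neighbors of the end of a dart that are not next to it on either side are large. -/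
def FarLarge (R : RotationSystem G) (d : G.Dart) : Prop :=
  10 ≤ sdeg (R.next (R.next d.symm)) ∧ 10 ≤ sdeg (R.mirror.next (R.mirror.next d.symm))

open Classical in
/-- The indicator of a proposition. -/
noncomputable def ind (p : Prop) : ℚ := if p then 1 else 0

theorem ind_nonneg (p : Prop) : 0 ≤ ind p := by unfold ind; split_ifs <;> norm_num
theorem ind_le_one (p : Prop) : ind p ≤ 1 := by unfold ind; split_ifs <;> norm_num
theorem ind_pos {p : Prop} (h : p) : ind p = 1 := if_pos h
theorem ind_neg {p : Prop} (h : ¬ p) : ind p = 0 := if_neg h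
theorem ind_mono {p q : Prop} (h : p → q) : ind p ≤ ind q := by
  by_cases hp : p
  · rw [ind_pos hp, ind_pos (h hp)]
  · rw [ind_neg hp]; exact ind_nonneg q

open Classical in
/-- What a dart receives through the corner before it, when every corner can spend `c`. -/
noncomputable def share (R : RotationSystem G) (c : ℚ) (d : G.Dart) : ℚ :=
  if R.IsTri d then (if sdeg (R.mirror.next d) = 5 then c / 2 else c) else c / 2 + 1 / 4

open Classical in
/-- What a tight vertex pays along a dart. -/
noncomputable def tightPay (R : RotationSystem G) (x y : ℚ) (d : G.Dart) : ℚ :=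
  if R.FarLarge d then 0 else if R.AllTri d.snd then x else y

/-- The neighbors before and after the next dart have degree different from five, or the corner
after the next dart is not triangular. -/
def Boosted (R : RotationSystem G) (d : G.Dart) : Prop :=
  sdeg (R.mirror.next d) ≠ 5 ∧ sdeg (R.next d) = 5 ∧
    (sdeg (R.next (R.next d)) ≠ 5 ∨ ¬ R.mirror.IsTri (R.next d))

open Classical in
/-- What a large vertex pays along a dart, before corrections between consecutive darts. -/
noncomputable def base (R : RotationSystem G) (d : G.Dart) : ℚ :=
  if sdeg d = 5 then
    if G.degree d.fst = 11 then
      if R.Tight d.fst then R.tightPay (1 / 2) (1 / 4) d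
      else 1 / 2 + (ind (R.Boosted d) + ind (R.mirror.Boosted d)) / 10
    else if G.degree d.fst = 13 then
      if R.Tight d.fst then R.tightPay (11 / 20) (2 / 5) d
      else 11 / 20 + (ind (sdeg (R.mirror.next d) ≠ 5) + ind (sdeg (R.next d) ≠ 5)) / 20
        + 7 / 20 * (ind (sdeg (R.mirror.next d) ≠ 5 ∧ sdeg (R.next d) ≠ 5))
    else if 10 ≤ G.degree d.fst then
      R.share (((G.degree d.fst : ℚ) - 6) / G.degree d.fst) d
        + R.mirror.share (((G.degree d.fst : ℚ) - 6) / G.degree d.fst) d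
    else 0
  else 0

/-- When a vertex of degree ten shifts a part of its payment from a dart to the next one. -/
def GivesTen (R : RotationSystem G) (d : G.Dart) : Prop :=
  G.degree d.fst = 10 ∧ sdeg d = 5 ∧ sdeg (R.next d) = 5 ∧
    (sdeg (R.mirror.next d) ≠ 5 ∨ ¬ R.IsTri d) ∧
    sdeg (R.mirror.next (R.mirror.next d.symm)) ≠ 10

/-- When a vertex of degree thirteen or fourteen shifts a part of its payment from a dart to the
next one. -/
def GivesThirteen (R : RotationSystem G) (d : G.Dart) : Prop :=
  (G.degree d.fst = 13 ∨ G.degree d.fst = 14) ∧ sdeg d = 5 ∧ sdeg (R.next d) = 5 ∧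
    sdeg (R.mirror.next d.symm) = 5 ∧ sdeg (R.mirror.next (R.mirror.next d.symm)) = 5 ∧
    (11 ≤ sdeg (R.mirror.next (R.mirror.next (R.mirror.next d.symm))) ∨
      ¬ R.IsTri (R.mirror.next (R.mirror.next d.symm))) ∧
    sdeg (R.next (R.next (R.next (R.next d).symm))) = 10

/-- The amount shifted from a dart to the next one. -/
noncomputable def give (R : RotationSystem G) (d : G.Dart) : ℚ :=
  ind (R.GivesTen d) / 10 + ind (R.GivesThirteen d) / 20

/-- What the initial vertex of a dart pays to its end. -/
noncomputable def pay (R : RotationSystem G) (d : G.Dart) : ℚ :=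
  R.base d + (R.give (R.mirror.next d) - R.give d) + (R.mirror.give (R.next d) - R.mirror.give d)

theorem farLarge_mirror (R : RotationSystem G) (d : G.Dart) :
    R.mirror.FarLarge d ↔ R.FarLarge d := by
  simp [FarLarge, and_comm]

theorem tightPay_mirror (R : RotationSystem G) (x y : ℚ) (d : G.Dart) :
    R.mirror.tightPay x y d = R.tightPay x y d := by
  unfold tightPay
  rw [propext (R.farLarge_mirror d), propext (R.allTri_mirror d.snd)]

theorem base_mirror (R : RotationSystem G) (d : G.Dart) : R.mirror.base d = R.base d := by
  unfold base
  rw [propext (R.tight_mirror d.fst)]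
  simp only [tightPay_mirror, mirror_mirror,
    add_comm (ind (R.mirror.Boosted d)), add_comm (ind (sdeg (R.next d) ≠ 5)),
    and_comm (a := sdeg (R.next d) ≠ 5), add_comm (R.mirror.share _ d)]

theorem pay_mirror (R : RotationSystem G) (d : G.Dart) : R.mirror.pay d = R.pay d := by
  simp only [pay, base_mirror, mirror_mirror]
  ring

theorem give_nonneg (R : RotationSystem G) (d : G.Dart) : 0 ≤ R.give d := by
  have := ind_nonneg (R.GivesTen d)
  have := ind_nonneg (R.GivesThirteen d)
  unfold give
  positivity

theorem give_eq_zero {R : RotationSystem G} {d : G.Dart} (h1 : ¬ R.GivesTen d)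
    (h2 : ¬ R.GivesThirteen d) : R.give d = 0 := by
  simp [give, ind_neg h1, ind_neg h2]

/-- A shift is subtracted at one dart and added at the next, so shifts cancel around the vertex and
only `base` matters for its budget. -/
theorem sum_pay (R : RotationSystem G) (v : V) :
    ∑ d ∈ out G v, R.pay d = ∑ d ∈ out G v, R.base d := by
  unfold pay
  rw [sum_add_distrib, sum_add_distrib, sum_sub_distrib, sum_sub_distrib,
    R.sum_out_next v R.mirror.give, R.mirror.sum_out_next v R.give]
  ring

theorem base_eq_zero_of_lt (R : RotationSystem G) {d : G.Dart} (h : G.degree d.fst < 10) :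
    R.base d = 0 := by
  unfold base
  split_ifs <;> first | rfl | omega

theorem pay_eq_zero_of_lt (R : RotationSystem G) {d : G.Dart} (h : G.degree d.fst < 10) :
    R.pay d = 0 := by
  have key : ∀ (S : RotationSystem G) (e : G.Dart), e.fst = d.fst → S.give e = 0 := by
    intro S e he
    refine give_eq_zero ?_ ?_
    · rintro ⟨h1, -⟩
      rw [he] at h1; omega
    · rintro ⟨h1, -⟩
      rw [he] at h1; omega
  simp [pay, base_eq_zero_of_lt R h, key]

theorem pay_eq_zero_of_ne (R : RotationSystem G) {d : G.Dart} (h : sdeg d ≠ 5) :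
    R.pay d = 0 := by
  have key : ∀ (S : RotationSystem G), S.give d = 0 := fun S =>
    give_eq_zero (fun h1 => h h1.2.1) (fun h1 => h h1.2.1)
  have key' : ∀ (S : RotationSystem G) (e), S.next e = d → S.give e = 0 := fun S e he =>
    give_eq_zero (fun h1 => h (he ▸ h1.2.2.1)) (fun h1 => h (he ▸ h1.2.2.1))
  rw [pay, key, key, key' R _ (by simp), key' R.mirror _ (by simp)]
  simp [base, h]

/-- The hypotheses of the theorem, negated conclusion included. -/
structure Starless (R : RotationSystem G) : Prop where
  five_le : ∀ v, 5 ≤ G.degree v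
  gap : ∀ v, G.degree v ≤ 6 ∨ 10 ≤ G.degree v
  star₁ : ¬ R.HasStar ![5, 6, 6, 5, ⊤]
  star₂ : ¬ R.HasStar ![5, 6, 6, 6, 17]
  star₃ : ¬ R.HasStar ![6, 6, 6, 6, 11]
  star₄ : ¬ R.HasStar ![5, 5, 10, 5, 12]

theorem HasStar.of_mirror {R : RotationSystem G} {κ : Fin 5 → ℕ∞} (h : R.mirror.HasStar κ) :
    R.HasStar κ := by
  obtain ⟨d, hd, h⟩ := h
  refine ⟨d, hd, ?_⟩
  have e : R.mirror.next⁻¹ = R.next := inv_inv R.next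
  rw [e] at h
  exact h.symm

theorem Starless.mirror {R : RotationSystem G} (h : R.Starless) : R.mirror.Starless :=
  ⟨h.five_le, h.gap, fun h' => h.star₁ h'.of_mirror, fun h' => h.star₂ h'.of_mirror,
    fun h' => h.star₃ h'.of_mirror, fun h' => h.star₄ h'.of_mirror⟩

theorem next_five (R : RotationSystem G) {h : G.Dart} (h5 : G.degree h.fst = 5) :
    R.next (R.next (R.next (R.next (R.next h)))) = h := by
  have := (R.iterate_next_eq_self h 5).2 (by rw [h5])
  simpa [pow_succ] using this

theorem next_three (R : RotationSystem G) {h : G.Dart} (h5 : G.degree h.fst = 5) :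
    R.next (R.next (R.next h)) = R.mirror.next (R.mirror.next h) := by
  have := congrArg (fun x => R.mirror.next (R.mirror.next x)) (R.next_five h5)
  simpa using this

/-- The last bound is put on the distinguished dart `h`, the payer in most uses; the other four
neighbors are read one and two steps away on either side, which keeps mirror arguments symmetric. -/
theorem hasStar_of_dart (R : RotationSystem G) {h : G.Dart} (h5 : G.degree h.fst = 5)
    {a b c d e : ℕ∞} (ha : (sdeg (R.next h) : ℕ∞) ≤ a) (hb : (sdeg (R.next (R.next h)) : ℕ∞) ≤ b)
    (hc : (sdeg (R.mirror.next (R.mirror.next h)) : ℕ∞) ≤ c)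
    (hd : (sdeg (R.mirror.next h) : ℕ∞) ≤ d) (he : (sdeg h : ℕ∞) ≤ e) :
    R.HasStar ![a, b, c, d, e] := by
  refine ⟨R.next h, by rw [R.fst_next]; exact h5, Or.inl ?_⟩
  have h3 := R.next_three h5
  have h4 : R.next (R.next (R.next (R.next h))) = R.mirror.next h := by rw [h3]; simp
  have e5 := R.next_five h5
  rw [← h3] at hc
  rw [← h4] at hd
  rw [← e5] at he
  intro i
  fin_cases i <;> simpa [pow_succ, sdeg] using by assumption

namespace Starless

variable {R : RotationSystem G}

theorem not_star₁ (S : R.Starless) {h : G.Dart} (h5 : G.degree h.fst = 5)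
    (h1 : sdeg (R.next h) ≤ 5) (h2 : sdeg (R.next (R.next h)) ≤ 6)
    (h3 : sdeg (R.mirror.next (R.mirror.next h)) ≤ 6) (h4 : sdeg (R.mirror.next h) ≤ 5) : False :=
  S.star₁ (R.hasStar_of_dart h5 (by exact_mod_cast h1) (by exact_mod_cast h2)
    (by exact_mod_cast h3) (by exact_mod_cast h4) le_top)

theorem not_star₂ (S : R.Starless) {h : G.Dart} (h5 : G.degree h.fst = 5)
    (h1 : sdeg (R.next h) ≤ 5) (h2 : sdeg (R.next (R.next h)) ≤ 6)
    (h3 : sdeg (R.mirror.next (R.mirror.next h)) ≤ 6) (h4 : sdeg (R.mirror.next h) ≤ 6)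
    (h0 : sdeg h ≤ 17) : False :=
  S.star₂ (R.hasStar_of_dart h5 (by exact_mod_cast h1) (by exact_mod_cast h2)
    (by exact_mod_cast h3) (by exact_mod_cast h4) (by exact_mod_cast h0))

theorem not_star₃ (S : R.Starless) {h : G.Dart} (h5 : G.degree h.fst = 5)
    (h1 : sdeg (R.next h) ≤ 6) (h2 : sdeg (R.next (R.next h)) ≤ 6)
    (h3 : sdeg (R.mirror.next (R.mirror.next h)) ≤ 6) (h4 : sdeg (R.mirror.next h) ≤ 6)
    (h0 : sdeg h ≤ 11) : False :=
  S.star₃ (R.hasStar_of_dart h5 (by exact_mod_cast h1) (by exact_mod_cast h2)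
    (by exact_mod_cast h3) (by exact_mod_cast h4) (by exact_mod_cast h0))

theorem not_star₄ (S : R.Starless) {h : G.Dart} (h5 : G.degree h.fst = 5)
    (h1 : sdeg (R.next h) ≤ 5) (h2 : sdeg (R.next (R.next h)) ≤ 5)
    (h3 : sdeg (R.mirror.next (R.mirror.next h)) ≤ 10) (h4 : sdeg (R.mirror.next h) ≤ 5)
    (h0 : sdeg h ≤ 12) : False :=
  S.star₄ (R.hasStar_of_dart h5 (by exact_mod_cast h1) (by exact_mod_cast h2)
    (by exact_mod_cast h3) (by exact_mod_cast h4) (by exact_mod_cast h0))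

end Starless

end Payments

/-! ### Large vertices can afford their payments. -/

section Budget

variable {V : Type*} [Fintype V] {G : SimpleGraph V} [DecidableRel G.Adj]

/-- Shares are regrouped by corner. A triangular corner spends `c` on one receiver or `c / 2` on
each of two; any other corner owns `c + 1/2` and offers half of it to each side. -/
theorem sum_share_le (R : RotationSystem G) (v : V) {c : ℚ} :
    ∑ d ∈ out G v, (if sdeg d = 5 then R.share c d + R.mirror.share c d else 0)
      ≤ ∑ d ∈ out G v, (|c| + R.cornerCharge d) := by
  have h1 : ∑ d ∈ out G v, (if sdeg d = 5 then R.share c d + R.mirror.share c d else 0)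
      = ∑ d ∈ out G v, (if sdeg d = 5 then R.share c d else 0)
        + ∑ d ∈ out G v, (if sdeg (R.mirror.next d) = 5 then
            R.mirror.share c (R.mirror.next d) else 0) := by
    rw [R.mirror.sum_out_next v fun d => if sdeg d = 5 then R.mirror.share c d else 0,
      ← sum_add_distrib]
    refine sum_congr rfl fun d _ => ?_
    split_ifs <;> simp
  rw [h1, ← sum_add_distrib]
  refine sum_le_sum fun d _ => ?_
  have hc := le_abs_self c
  have hc' := abs_nonneg c
  unfold share cornerCharge
  rw [propext (R.mirror_isTri_mirror_next d)]
  simp only [mirror_mirror, next_mirror_next]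
  split_ifs <;> linarith

theorem next_next_next_ne (R : RotationSystem G) {d : G.Dart} (hd : 10 ≤ G.degree d.fst) :
    R.next (R.next (R.next d)) ≠ d := by
  intro h
  have := (R.iterate_next_eq_self d 3).1 (by simpa [pow_succ] using h)
  have := Nat.le_of_dvd (by norm_num) this
  omega

theorem next_next_ne (R : RotationSystem G) {d : G.Dart} (hd : 10 ≤ G.degree d.fst) :
    R.next (R.next d) ≠ d := by
  intro h
  have := (R.iterate_next_eq_self d 2).1 (by simpa [pow_succ] using h)
  have := Nat.le_of_dvd (by norm_num) this
  omega

theorem next_ne (R : RotationSystem G) {d : G.Dart} (hd : 5 ≤ G.degree d.fst) :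
    R.next d ≠ d := by
  intro h
  have := (R.iterate_next_eq_self d 1).1 (by simpa [pow_succ] using h)
  have := Nat.le_of_dvd (by norm_num) this
  omega

theorem two_le_sum_ind {v : V} (p : G.Dart → Prop) {d e : G.Dart} (hd : d.fst = v)
    (he : e.fst = v) (hne : d ≠ e) (hpd : p d) (hpe : p e) :
    2 ≤ ∑ d ∈ out G v, ind (p d) := by
  classical
  have hsub : ({d, e} : Finset G.Dart) ⊆ out G v := by
    intro x hx
    simp only [mem_insert, mem_singleton] at hx
    rcases hx with rfl | rfl
    exacts [mem_out.2 hd, mem_out.2 he]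
  refine le_trans ?_ (sum_le_sum_of_subset_of_nonneg hsub fun x _ _ => ind_nonneg _)
  rw [sum_pair hne, ind_pos hpd, ind_pos hpe]
  norm_num

theorem one_le_sum_ind {v : V} (p : G.Dart → Prop) {d : G.Dart} (hd : d.fst = v) (hpd : p d) :
    1 ≤ ∑ d ∈ out G v, ind (p d) := by
  have := single_le_sum (f := fun d => ind (p d)) (fun x _ => ind_nonneg _) (mem_out.2 hd)
  simpa [ind_pos hpd] using this

theorem sum_const_out (v : V) (c : ℚ) : ∑ _d ∈ out G v, c = G.degree v * c := by
  rw [sum_const, card_out, nsmul_eq_mul]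

theorem sum_cornerCharge_out (R : RotationSystem G) (v : V) :
    ∑ d ∈ out G v, R.cornerCharge d = (∑ d ∈ out G v, ind (¬ R.IsTri d)) / 2 := by
  rw [sum_div]
  refine sum_congr rfl fun d _ => ?_
  unfold cornerCharge ind
  split_ifs <;> simp_all

/-- A vertex that is not tight has a neighbor of degree different from five, or a corner in a face
that is not a triangle. -/
theorem exists_of_not_tight {R : RotationSystem G} {v : V} (h : ¬ R.Tight v) :
    1 ≤ ∑ d ∈ out G v, ind (sdeg d ≠ 5) ∨ 1 ≤ ∑ d ∈ out G v, ind (¬ R.IsTri d) := by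
  unfold Tight at h
  push Not at h
  obtain ⟨d, hd, h⟩ := h
  by_cases h5 : sdeg d = 5
  · right
    by_cases ht : R.IsTri d
    · exact one_le_sum_ind (fun d => ¬ R.IsTri d) (d := R.next d) (by simpa using hd)
        (fun h' => h h5 ht ((R.mirror_isTri d).2 h'))
    · exact one_le_sum_ind (fun d => ¬ R.IsTri d) hd ht
  · left
    exact one_le_sum_ind (fun d => sdeg d ≠ 5) hd h5

/-- The two neighbors named in `Boosted` are three steps apart, hence distinct around a large
vertex. -/
theorem two_le_of_boosted {R : RotationSystem G} {d : G.Dart} (hd : 10 ≤ G.degree d.fst)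
    (h : R.Boosted d) : 2 ≤ ∑ d ∈ out G d.fst, ind (sdeg d ≠ 5) ∨
      1 ≤ ∑ d ∈ out G d.fst, ind (¬ R.IsTri d) := by
  obtain ⟨h1, h2, h3 | h3⟩ := h
  · left
    refine two_le_sum_ind (fun d => sdeg d ≠ 5) (by simp) (by simp) ?_ h1 h3
    intro h
    have := R.next_next_next_ne (d := R.mirror.next d) (by simpa using hd)
    rw [next_mirror_next, ← h] at this
    exact this rfl
  · right
    exact one_le_sum_ind (fun d => ¬ R.IsTri d) (d := R.next (R.next d)) (by simp)
      (by rwa [mirror_isTri] at h3)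

/-- Paying 1/2 to all eleven neighbors exceeds the budget 5 by 1/2. A neighbor of degree other than
5 saves 1/2 and causes at most two boosts of 1/10, so one suffices without boosts and two suffice
with them; a non-triangular corner covers the excess at once. -/
theorem sum_base_eleven_le (R : RotationSystem G) {v : V} (hv : G.degree v = 11)
    (ht : ¬ R.Tight v) :
    ∑ d ∈ out G v, R.base d ≤ 5 + ∑ d ∈ out G v, R.cornerCharge d := by
  rw [sum_cornerCharge_out]
  have hm := exists_of_not_tight ht
  set m := ∑ d ∈ out G v, ind (sdeg d ≠ 5) with hm_def
  set n := ∑ d ∈ out G v, ind (¬ R.IsTri d)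
  have hm0 : 0 ≤ m := sum_nonneg fun d _ => ind_nonneg _
  have hn0 : 0 ≤ n := sum_nonneg fun d _ => ind_nonneg _
  have hcount : ∑ d ∈ out G v, (1 / 2 - ind (sdeg d ≠ 5) / 2) = 11 / 2 - m / 2 := by
    rw [sum_sub_distrib, sum_const_out, hv, ← sum_div]
    push_cast
    ring
  have hbase : ∀ d ∈ out G v, R.base d ≤ (1 / 2 - ind (sdeg d ≠ 5) / 2)
      + (ind (R.Boosted d) + ind (R.mirror.Boosted d)) / 10 := by
    intro d hd
    rw [mem_out] at hd
    have h1 := ind_nonneg (R.Boosted d)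
    have h2 := ind_nonneg (R.mirror.Boosted d)
    unfold base
    rw [hd, hv]
    by_cases h5 : sdeg d = 5
    · simp [h5, ht, ind_neg]
    · simp only [h5, if_false]
      rw [ind_pos h5]
      linarith
  by_cases hb : ∃ d ∈ out G v, R.Boosted d ∨ R.mirror.Boosted d
  · have hmn : 2 ≤ m ∨ 1 ≤ n := by
      obtain ⟨d, hd, hb⟩ := hb
      rw [mem_out] at hd
      subst hd
      rcases hb with hb | hb
      · exact two_le_of_boosted (by omega) hb
      · rcases two_le_of_boosted (by omega) hb with h | h
        · exact Or.inl h
        · right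
          refine h.trans_eq ?_
          refine Eq.trans ?_ (R.sum_out_next d.fst fun d => ind (¬ R.IsTri d))
          exact sum_congr rfl fun e _ => by rw [propext (R.mirror_isTri e)]
    have hboost : ∑ d ∈ out G v, (ind (R.Boosted d) + ind (R.mirror.Boosted d)) / 10
        ≤ (m + m) / 10 := by
      rw [← sum_div, sum_add_distrib]
      have h1 : ∑ d ∈ out G v, ind (R.Boosted d) ≤ m := by
        rw [hm_def, ← R.mirror.sum_out_next v fun d => ind (sdeg d ≠ 5)]
        exact sum_le_sum fun d _ => ind_mono fun h => h.1
      have h2 : ∑ d ∈ out G v, ind (R.mirror.Boosted d) ≤ m := by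
        rw [hm_def, ← R.sum_out_next v fun d => ind (sdeg d ≠ 5)]
        refine sum_le_sum fun d _ => ind_mono fun h => ?_
        simpa using h.1
      linarith
    have := sum_le_sum hbase
    rw [sum_add_distrib, hcount] at this
    rcases hmn with h | h <;> linarith
  · push Not at hb
    have : ∑ d ∈ out G v, R.base d ≤ ∑ d ∈ out G v, (1 / 2 - ind (sdeg d ≠ 5) / 2) := by
      refine sum_le_sum fun d hd => (hbase d hd).trans_eq ?_
      rw [ind_neg (hb d hd).1, ind_neg (hb d hd).2]
      ring
    rw [hcount] at this
    rcases hm with h | h <;> linarith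

/-- The excess is `13 * 11/20 - 7 = 3/20`. A neighbor of degree other than 5 saves 11/20 and
triggers extras of at most `2/20 + 7/20`. The term 7/20 occurs only if there are two such neighbors,
and then the net saving of 1/10 from each is enough. -/
theorem sum_base_thirteen_le (R : RotationSystem G) {v : V} (hv : G.degree v = 13)
    (ht : ¬ R.Tight v) :
    ∑ d ∈ out G v, R.base d ≤ 7 + ∑ d ∈ out G v, R.cornerCharge d := by
  rw [sum_cornerCharge_out]
  have hm := exists_of_not_tight ht
  set m := ∑ d ∈ out G v, ind (sdeg d ≠ 5) with hm_def
  set n := ∑ d ∈ out G v, ind (¬ R.IsTri d)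
  have hm0 : 0 ≤ m := sum_nonneg fun d _ => ind_nonneg _
  have hn0 : 0 ≤ n := sum_nonneg fun d _ => ind_nonneg _
  have hcount : ∑ d ∈ out G v, (11 / 20 - 11 / 20 * ind (sdeg d ≠ 5)) =
      143 / 20 - 11 / 20 * m := by
    rw [sum_sub_distrib, sum_const_out, hv, ← mul_sum]
    push_cast
    ring
  have hprev : ∑ d ∈ out G v, ind (sdeg (R.mirror.next d) ≠ 5) = m :=
    R.mirror.sum_out_next v fun d => ind (sdeg d ≠ 5)
  have hnext : ∑ d ∈ out G v, ind (sdeg (R.next d) ≠ 5) = m :=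
    R.sum_out_next v fun d => ind (sdeg d ≠ 5)
  set B := ∑ d ∈ out G v, ind (sdeg (R.mirror.next d) ≠ 5 ∧ sdeg (R.next d) ≠ 5)
    with hB_def
  have hB : B ≤ m := by
    rw [← hnext]
    exact sum_le_sum fun d _ => ind_mono fun h => h.2
  have hB2 : B ≤ 0 ∨ 2 ≤ m := by
    by_cases hb : ∃ d ∈ out G v, sdeg (R.mirror.next d) ≠ 5 ∧ sdeg (R.next d) ≠ 5
    · right
      obtain ⟨d, hd, h1, h2⟩ := hb
      rw [mem_out] at hd
      refine two_le_sum_ind (fun d => sdeg d ≠ 5) (by simpa using hd) (by simpa using hd) ?_ h1 h2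
      intro h
      have := R.next_next_ne (d := R.mirror.next d) (by rw [degree_next_fst, hd, hv]; norm_num)
      rw [next_mirror_next, ← h] at this
      exact this rfl
    · left
      push Not at hb
      refine sum_nonpos fun d hd => ?_
      rw [ind_neg fun h => h.2 (hb d hd h.1)]
  have hbase : ∀ d ∈ out G v, R.base d ≤ (11 / 20 - 11 / 20 * ind (sdeg d ≠ 5))
      + ((ind (sdeg (R.mirror.next d) ≠ 5) + ind (sdeg (R.next d) ≠ 5)) / 20
        + 7 / 20 * (ind (sdeg (R.mirror.next d) ≠ 5 ∧ sdeg (R.next d) ≠ 5))) := by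
    intro d hd
    rw [mem_out] at hd
    have h1 := ind_nonneg (sdeg (R.mirror.next d) ≠ 5)
    have h2 := ind_nonneg (sdeg (R.next d) ≠ 5)
    have h3 := ind_nonneg (sdeg (R.mirror.next d) ≠ 5 ∧ sdeg (R.next d) ≠ 5)
    unfold base
    rw [hd, hv]
    by_cases h5 : sdeg d = 5
    · rw [ind_neg (p := sdeg d ≠ 5) (by simp [h5])]
      simp only [h5, ht, if_true, if_false]
      norm_num
      linarith
    · simp only [h5, if_false]
      rw [ind_pos h5]
      linarith
  have := sum_le_sum hbase
  rw [sum_add_distrib, hcount, sum_add_distrib, ← sum_div, sum_add_distrib, ← mul_sum, hprev,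
    hnext] at this
  rcases hB2 with h | h <;> rcases hm with h' | h' <;> linarith

theorem tightPay_le (R : RotationSystem G) {x y : ℚ} (hy : 0 ≤ y) (hyx : y ≤ x) (d : G.Dart) :
    R.tightPay x y d ≤ x := by
  unfold tightPay
  split_ifs <;> linarith

theorem tightPay_le_of_not_allTri (R : RotationSystem G) {x y : ℚ} (hy : 0 ≤ y) {d : G.Dart}
    (h : ¬ R.AllTri d.snd) : R.tightPay x y d ≤ y := by
  unfold tightPay
  split_ifs <;> linarith

/-- Around a tight vertex of odd degree, there is an end that needs nothing, or there are two
consecutive ends with corners in faces that are not triangles. -/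
theorem Tight.exists_saving {R : RotationSystem G} (S : R.Starless) {v : V} (ht : R.Tight v)
    (hodd : Odd (G.degree v)) : (∃ d, d.fst = v ∧ R.FarLarge d) ∨
      ∃ d, d.fst = v ∧ ¬ R.AllTri d.snd ∧ ¬ R.AllTri (R.next d).snd := by
  by_contra! hcon
  obtain ⟨hz, hn⟩ := hcon
  -- The face across the edge joining two consecutive neighbors is a triangle; otherwise both ends
  -- of that edge have a non-triangular corner, which is the second alternative.
  have htri : ∀ d : G.Dart, d.fst = v → R.IsTri (R.mirror.next d.symm) := by
    intro d hd
    by_contra h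
    have h1 : ¬ R.AllTri d.snd := fun h' => h (h' _ (by simp)).1
    have h2 := (hn d hd h1 (R.next (R.mirror.next d.symm).symm) (by
      simp [(ht d hd).2.2.snd_mirror_next_symm])).1
    exact h ((R.isTri_next_symm _).1 h2)
  -- Hence both ends of that edge see the same apex.
  have hfar : ∀ d : G.Dart, d.fst = v → sdeg (R.next (R.next (R.next d).symm)) =
      sdeg (R.mirror.next (R.mirror.next d.symm)) := by
    intro d hd
    have h1 := (htri d hd).snd_next_symm
    have h2 := (ht d hd).2.2.mirror_next_symm_of_mirror
    have h3 : (R.mirror.next d.symm).symm = R.next (R.next d).symm := by rw [h2]; simp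
    rw [h3] at h1
    unfold sdeg
    rw [h1]
  -- The far neighbors of an end are the apexes over two consecutive edges. They are not both large
  -- by `hz`, and not both small by the first star, so large and small apexes alternate.
  have hflip : ∀ d : G.Dart, d.fst = v →
      (10 ≤ sdeg (R.mirror.next (R.mirror.next (R.next d).symm)) ↔
        ¬ 10 ≤ sdeg (R.mirror.next (R.mirror.next d.symm))) := by
    intro d hd
    have hd' : (R.next d).fst = v := by simpa using hd
    have hz' := hz _ hd'
    unfold FarLarge at hz'
    rw [hfar d hd] at hz'
    constructor
    · exact fun h1 h2 => hz' ⟨h2, h1⟩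
    · intro h1
      by_contra h2
      obtain ⟨e5, et, et'⟩ := ht _ hd'
      have hside := et.snd_next_symm
      have hside' := et'.snd_mirror_next_symm
      refine S.not_star₁ (h := (R.next d).symm) e5 ?_ ?_ ?_ ?_
      · rw [sdeg, hside, mirror_next_next]
        exact (ht d hd).1.le
      · rw [hfar d hd]
        exact (S.gap _).resolve_right h1
      · exact (S.gap _).resolve_right h2
      · rw [sdeg, hside']
        exact (ht (R.next (R.next d)) (by simpa using hd)).1.le
  obtain ⟨d, hd⟩ : (out G v).Nonempty := by
    rw [← card_pos, card_out]
    exact hodd.pos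
  rw [mem_out] at hd
  have hiter : ∀ n : ℕ, ((R.next ^ n) d).fst = v ∧
      (10 ≤ sdeg (R.mirror.next (R.mirror.next ((R.next ^ n) d).symm)) ↔
        (Even n ↔ 10 ≤ sdeg (R.mirror.next (R.mirror.next d.symm)))) := by
    intro n
    induction n with
    | zero => simpa using hd
    | succ n ih =>
      rw [pow_succ', Equiv.Perm.mul_apply]
      refine ⟨by simpa using ih.1, ?_⟩
      rw [hflip _ ih.1, ih.2, Nat.even_add_one]
      tauto
  -- Alternation cannot close up after an odd number of steps.
  have h1 := (hiter (G.degree v)).2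
  rw [(R.iterate_next_eq_self d (G.degree v)).2 (by rw [hd])] at h1
  rw [← Nat.not_even_iff_odd] at hodd
  tauto

/-- An end that takes nothing saves `x`; two ends with non-triangular corners save `x - y` each. -/
theorem sum_tightPay_le {R : RotationSystem G} (S : R.Starless) {v : V} (ht : R.Tight v)
    (hodd : Odd (G.degree v)) {x y : ℚ} (hy : 0 ≤ y) (hyx : y ≤ x) :
    ∑ d ∈ out G v, R.tightPay x y d ≤ G.degree v * x - min x (2 * (x - y)) := by
  classical
  have h5 := S.five_le v
  have hle : ∀ s ⊆ out G v, ∑ d ∈ out G v, (x - R.tightPay x y d) ≥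
      ∑ d ∈ s, (x - R.tightPay x y d) := fun s hs =>
    sum_le_sum_of_subset_of_nonneg hs fun d _ _ => sub_nonneg.2 (R.tightPay_le hy hyx d)
  have hsum : ∑ d ∈ out G v, (x - R.tightPay x y d) =
      G.degree v * x - ∑ d ∈ out G v, R.tightPay x y d := by
    rw [sum_sub_distrib, sum_const_out]
  rcases ht.exists_saving S hodd with ⟨d, hd, hz⟩ | ⟨d, hd, h1, h2⟩
  · have h := hle {d} (by simpa [mem_out] using hd)
    rw [hsum, sum_singleton] at h
    have : R.tightPay x y d = 0 := by unfold tightPay; rw [if_pos hz]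
    have := min_le_left x (2 * (x - y))
    linarith
  · have hne : d ≠ R.next d := (R.next_ne (by rw [hd]; exact h5)).symm
    have h := hle {d, R.next d} (by
      intro e he
      simp only [mem_insert, mem_singleton] at he
      rcases he with rfl | rfl <;> simpa [mem_out] using hd)
    rw [hsum, sum_pair hne] at h
    have := R.tightPay_le_of_not_allTri (x := x) hy h1
    have := R.tightPay_le_of_not_allTri (x := x) hy h2
    have := min_le_right x (2 * (x - y))
    linarith

/-- A large vertex can afford what it pays. -/
theorem sum_base_le {R : RotationSystem G} (S : R.Starless) {v : V} (hv : 10 ≤ G.degree v) :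
    ∑ d ∈ out G v, R.base d ≤ (G.degree v - 6) + ∑ d ∈ out G v, R.cornerCharge d := by
  have hcc : 0 ≤ ∑ d ∈ out G v, R.cornerCharge d := sum_nonneg fun d _ => R.cornerCharge_nonneg d
  by_cases h11 : G.degree v = 11
  · by_cases ht : R.Tight v
    · have h1 := sum_tightPay_le S ht (by rw [h11]; decide) (x := 1 / 2) (y := 1 / 4)
        (by norm_num) (by norm_num)
      have h2 : ∑ d ∈ out G v, R.base d = ∑ d ∈ out G v, R.tightPay (1 / 2) (1 / 4) d := by
        refine sum_congr rfl fun d hd => ?_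
        rw [mem_out] at hd
        unfold base
        rw [if_pos (ht d hd).1, hd, if_pos h11, if_pos ht]
      rw [h11] at h1 ⊢
      norm_num at h1 h2 ⊢
      linarith
    · have := R.sum_base_eleven_le h11 ht
      rw [h11]
      norm_num
      linarith
  by_cases h13 : G.degree v = 13
  · by_cases ht : R.Tight v
    · have h1 := sum_tightPay_le S ht (by rw [h13]; decide) (x := 11 / 20) (y := 2 / 5)
        (by norm_num) (by norm_num)
      have h2 : ∑ d ∈ out G v, R.base d = ∑ d ∈ out G v, R.tightPay (11 / 20) (2 / 5) d := by
        refine sum_congr rfl fun d hd => ?_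
        rw [mem_out] at hd
        unfold base
        rw [if_pos (ht d hd).1, hd, if_neg h11, if_pos h13, if_pos ht]
      rw [h13] at h1 ⊢
      norm_num at h1 h2 ⊢
      linarith
    · have := R.sum_base_thirteen_le h13 ht
      rw [h13]
      norm_num
      linarith
  have hv' : (10 : ℚ) ≤ G.degree v := by exact_mod_cast hv
  have h := R.sum_share_le v (c := ((G.degree v : ℚ) - 6) / G.degree v)
  rw [abs_of_nonneg (div_nonneg (by linarith) (by linarith)), sum_add_distrib, sum_const_out,
    mul_div_cancel₀ _ (by positivity)] at h
  refine le_trans (le_of_eq (sum_congr rfl fun d hd => ?_)) h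
  rw [mem_out] at hd
  unfold base
  rw [hd]
  simp only [h11, h13, hv, if_true, if_false]

end Budget

/-! ### Lower bounds for single payments. -/

section Bounds

variable {V : Type*} [Fintype V] {G : SimpleGraph V} [DecidableRel G.Adj]

theorem give_le (R : RotationSystem G) (d : G.Dart) : R.give d ≤ 1 / 10 := by
  unfold give
  by_cases h : R.GivesTen d
  · rw [ind_neg (p := R.GivesThirteen d) (by
      rintro ⟨h1, -⟩
      have := h.1
      omega)]
    have := ind_le_one (R.GivesTen d)
    linarith
  · rw [ind_neg h]
    have := ind_le_one (R.GivesThirteen d)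
    linarith

theorem give_le_of_ne {R : RotationSystem G} {d : G.Dart} (h : G.degree d.fst ≠ 10) :
    R.give d ≤ 1 / 20 := by
  unfold give
  rw [ind_neg (p := R.GivesTen d) fun h1 => h h1.1]
  have := ind_le_one (R.GivesThirteen d)
  linarith

theorem give_eq_zero_of_degree {R : RotationSystem G} {d : G.Dart} (h : G.degree d.fst ≠ 10)
    (h3 : G.degree d.fst ≠ 13) (h4 : G.degree d.fst ≠ 14) : R.give d = 0 :=
  give_eq_zero (fun h1 => h h1.1) (fun h1 => h1.1.elim h3 h4)

theorem give_eq_zero_of_next {R : RotationSystem G} {d : G.Dart} (h : sdeg (R.next d) ≠ 5) :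
    R.give d = 0 :=
  give_eq_zero (fun h1 => h h1.2.2.1) (fun h1 => h h1.2.2.1)

theorem base_sub_give_le_pay (R : RotationSystem G) (d : G.Dart) :
    R.base d - R.give d - R.mirror.give d ≤ R.pay d := by
  have h1 := R.give_nonneg (R.mirror.next d)
  have h2 := R.mirror.give_nonneg (R.next d)
  unfold pay
  linarith

theorem base_eq_share {R : RotationSystem G} {d : G.Dart} (h5 : sdeg d = 5)
    (h10 : 10 ≤ G.degree d.fst) (h11 : G.degree d.fst ≠ 11) (h13 : G.degree d.fst ≠ 13) :
    R.base d = R.share (((G.degree d.fst : ℚ) - 6) / G.degree d.fst) d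
      + R.mirror.share (((G.degree d.fst : ℚ) - 6) / G.degree d.fst) d := by
  unfold base
  simp only [h5, h10, h11, h13, if_true, if_false]

theorem le_ratio {n m : ℕ} (hm : 0 < m) (h : m ≤ n) :
    ((m : ℚ) - 6) / m ≤ ((n : ℚ) - 6) / n := by
  have hm' : (0 : ℚ) < m := by exact_mod_cast hm
  have h' : (m : ℚ) ≤ n := by exact_mod_cast h
  rw [div_le_div_iff₀ hm' (by linarith)]
  nlinarith

theorem half_le_share (R : RotationSystem G) {c : ℚ} (hc : 0 ≤ c) (d : G.Dart) :
    c / 2 ≤ R.share c d := by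
  unfold share
  split_ifs <;> linarith

theorem share_eq {R : RotationSystem G} {c : ℚ} {d : G.Dart} (ht : R.IsTri d)
    (h : sdeg (R.mirror.next d) ≠ 5) : R.share c d = c := by
  unfold share
  rw [if_pos ht, if_neg h]

/-! ### Degree ten -/

theorem share_sub_give_ten {R : RotationSystem G} {d : G.Dart}
    (h : sdeg (R.mirror.next d) ≠ 5 ∨ ¬ R.IsTri d) : 3 / 10 ≤ R.share (2 / 5) d - R.give d := by
  have h1 := R.give_le d
  unfold share
  split_ifs with h2 h3
  · simp_all
  · linarith
  · linarith

/-- A vertex of degree ten shifts 1/10 only away from a dart whose share on that side is at least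
2/5. -/
theorem fifth_le_share_sub_give_ten {R : RotationSystem G} {d : G.Dart}
    (h10 : G.degree d.fst = 10) : 1 / 5 ≤ R.share (2 / 5) d - R.give d := by
  by_cases h : sdeg (R.mirror.next d) ≠ 5 ∨ ¬ R.IsTri d
  · have := share_sub_give_ten h
    linarith
  · have : R.give d = 0 := give_eq_zero (fun h1 => h h1.2.2.2.1) (by
      rintro ⟨h1, -⟩
      omega)
    have := R.half_le_share (c := 2 / 5) (by norm_num) d
    linarith

theorem base_ten {R : RotationSystem G} {d : G.Dart} (h5 : sdeg d = 5)
    (h10 : G.degree d.fst = 10) :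
    R.base d = R.share (2 / 5) d + R.mirror.share (2 / 5) d := by
  rw [base_eq_share h5 (by omega) (by omega) (by omega), h10]
  norm_num

theorem two_fifths_le_pay_ten {R : RotationSystem G} {d : G.Dart} (h5 : sdeg d = 5)
    (h10 : G.degree d.fst = 10) : 2 / 5 + R.mirror.give (R.next d) ≤ R.pay d := by
  have h1 := fifth_le_share_sub_give_ten (R := R) h10
  have h2 := fifth_le_share_sub_give_ten (R := R.mirror) h10
  have h3 := R.give_nonneg (R.mirror.next d)
  rw [pay, base_ten h5 h10]
  linarith

theorem half_le_pay_ten {R : RotationSystem G} {d : G.Dart} (h5 : sdeg d = 5)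
    (h10 : G.degree d.fst = 10) (h : sdeg (R.mirror.next d) ≠ 5 ∨ ¬ R.IsTri d) :
    1 / 2 ≤ R.pay d := by
  have h1 := share_sub_give_ten h
  have h2 := fifth_le_share_sub_give_ten (R := R.mirror) h10
  have h3 := R.base_sub_give_le_pay d
  rw [base_ten h5 h10] at h3
  linarith

/-! ### Degrees eleven and thirteen -/

theorem base_eleven {R : RotationSystem G} {d : G.Dart} (h5 : sdeg d = 5)
    (h11 : G.degree d.fst = 11) (ht : ¬ R.Tight d.fst) :
    R.base d = 1 / 2 + (ind (R.Boosted d) + ind (R.mirror.Boosted d)) / 10 := by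
  unfold base
  simp only [h5, h11, ht, if_true, if_false]

theorem base_eleven_tight {R : RotationSystem G} {d : G.Dart} (h5 : sdeg d = 5)
    (h11 : G.degree d.fst = 11) (ht : R.Tight d.fst) :
    R.base d = R.tightPay (1 / 2) (1 / 4) d := by
  unfold base
  simp only [h5, h11, ht, if_true]

theorem base_thirteen {R : RotationSystem G} {d : G.Dart} (h5 : sdeg d = 5)
    (h13 : G.degree d.fst = 13) (ht : ¬ R.Tight d.fst) :
    R.base d = 11 / 20 + (ind (sdeg (R.mirror.next d) ≠ 5) + ind (sdeg (R.next d) ≠ 5)) / 20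
        + 7 / 20 * (ind (sdeg (R.mirror.next d) ≠ 5 ∧ sdeg (R.next d) ≠ 5)) := by
  unfold base
  rw [if_pos h5, if_neg (by omega), if_pos h13, if_neg ht]

theorem base_thirteen_tight {R : RotationSystem G} {d : G.Dart} (h5 : sdeg d = 5)
    (h13 : G.degree d.fst = 13) (ht : R.Tight d.fst) :
    R.base d = R.tightPay (11 / 20) (2 / 5) d := by
  unfold base
  rw [if_pos h5, if_neg (by omega), if_pos h13, if_pos ht]

theorem eleven_twentieths_le_base_thirteen {R : RotationSystem G} {d : G.Dart}
    (h5 : sdeg d = 5) (h13 : G.degree d.fst = 13) (ht : ¬ R.Tight d.fst) :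
    11 / 20 ≤ R.base d := by
  rw [base_thirteen h5 h13 ht]
  have h1 := ind_nonneg (sdeg (R.mirror.next d) ≠ 5)
  have h2 := ind_nonneg (sdeg (R.next d) ≠ 5)
  have h3 := ind_nonneg (sdeg (R.mirror.next d) ≠ 5 ∧ sdeg (R.next d) ≠ 5)
  linarith

theorem quarter_le_tightPay {R : RotationSystem G} {x y : ℚ} {d : G.Dart} (hyx : y ≤ x)
    (hf : ¬ R.FarLarge d) : y ≤ R.tightPay x y d := by
  unfold tightPay
  rw [if_neg hf]
  split_ifs
  · exact hyx
  · exact le_rfl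

theorem tightPay_eq {R : RotationSystem G} {x y : ℚ} {d : G.Dart} (ha : R.AllTri d.snd)
    (hf : ¬ R.FarLarge d) : R.tightPay x y d = x := by
  unfold tightPay
  rw [if_neg hf, if_pos ha]

theorem give_eq_zero_of_farLarge {R : RotationSystem G} {d : G.Dart} (h : G.degree d.fst ≠ 10)
    (hf : R.FarLarge d) : R.give d = 0 := by
  refine give_eq_zero (fun h1 => h h1.1) fun h1 => ?_
  have := h1.2.2.2.2.1
  have := hf.2
  omega

/-- A vertex does not shift its payment from one dart to both sides. -/
theorem give_add_give_le {R : RotationSystem G} {d : G.Dart} (h5 : sdeg d = 5)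
    (h : G.degree d.fst ≠ 10) (ha : R.AllTri d.snd) : R.give d + R.mirror.give d ≤ 1 / 20 := by
  have h1 := give_le_of_ne (R := R) h
  have h2 := give_le_of_ne (R := R.mirror) h
  by_cases h3 : R.GivesThirteen d
  · by_cases h4 : R.mirror.GivesThirteen d
    · exfalso
      -- One shift needs a far neighbor of the receiver to have degree 5; the opposite shift needs
      -- the same neighbor to have degree at least 11 or a non-triangular corner.
      have h6 := h4.2.2.2.2.1
      have h7 : R.mirror.next (R.mirror.next (R.mirror.next d.symm)) =
          R.next (R.next d.symm) := by
        simpa using R.mirror.next_three (h := d.symm) h5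
      rcases h3.2.2.2.2.2.1 with h8 | h8
      · rw [h7] at h8
        simp only [mirror_mirror] at h6
        omega
      · exact h8 (ha _ (by simp)).1
    · rw [give_eq_zero (R := R.mirror) (fun h1 => h h1.1) h4]
      linarith
  · rw [give_eq_zero (R := R) (fun h1 => h h1.1) h3]
    linarith

/-! ### Bounds for all large degrees -/

theorem degree_cases {n : ℕ} (h : 10 ≤ n) :
    n = 10 ∨ n = 11 ∨ n = 12 ∨ n = 13 ∨ n = 14 ∨ 15 ≤ n := by
  omega

/-- A lower bound for the payments of vertices of degree twelve, fourteen and more. -/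
theorem ratio_le_base {R : RotationSystem G} {d : G.Dart} (h5 : sdeg d = 5)
    (h10 : 10 ≤ G.degree d.fst) (h11 : G.degree d.fst ≠ 11) (h13 : G.degree d.fst ≠ 13)
    {m : ℕ} (hm : 6 ≤ m) (h : m ≤ G.degree d.fst) : ((m : ℚ) - 6) / m ≤ R.base d := by
  have h1 := le_ratio (by omega) h
  have hm' : (6 : ℚ) ≤ m := by exact_mod_cast hm
  have h0 : 0 ≤ ((m : ℚ) - 6) / m := div_nonneg (by linarith) (by linarith)
  rw [base_eq_share h5 h10 h11 h13]
  have h2 := R.half_le_share (h0.trans h1) d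
  have h3 := R.mirror.half_le_share (h0.trans h1) d
  linarith

/-- Such a receiver loses at most one shift of 1/20, made only by degrees 13 and 14, where `11/20 -
1/20` and `4/7 - 1/20` are still at least 1/2. -/
theorem half_le_pay {R : RotationSystem G} {d : G.Dart} (h5 : sdeg d = 5)
    (h11 : 11 ≤ G.degree d.fst) (ha : R.AllTri d.snd) (hf : ¬ R.Tight d.fst ∨ ¬ R.FarLarge d) :
    1 / 2 ≤ R.pay d := by
  have hp := R.base_sub_give_le_pay d
  have hg := give_add_give_le h5 (by omega) ha
  rcases degree_cases (show 10 ≤ G.degree d.fst by omega) with h | h | h | h | h | h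
  · omega
  · rw [give_eq_zero_of_degree (by omega) (by omega) (by omega),
      give_eq_zero_of_degree (by omega) (by omega) (by omega)] at hp
    by_cases ht : R.Tight d.fst
    · rw [base_eleven_tight h5 h ht, tightPay_eq ha (hf.resolve_left (not_not.2 ht))] at hp
      linarith
    · rw [base_eleven h5 h ht] at hp
      have := ind_nonneg (R.Boosted d)
      have := ind_nonneg (R.mirror.Boosted d)
      linarith
  · rw [give_eq_zero_of_degree (by omega) (by omega) (by omega),
      give_eq_zero_of_degree (by omega) (by omega) (by omega)] at hp
    have := ratio_le_base (R := R) h5 (by omega) (by omega) (by omega) (m := 12) (by norm_num) h.ge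
    norm_num at this
    linarith
  · by_cases ht : R.Tight d.fst
    · rw [base_thirteen_tight h5 h ht, tightPay_eq ha (hf.resolve_left (not_not.2 ht))] at hp
      linarith
    · have := eleven_twentieths_le_base_thirteen h5 h ht
      linarith
  · have := ratio_le_base (R := R) h5 (by omega) (by omega) (by omega) (m := 14) (by norm_num) h.ge
    norm_num at this
    linarith
  · have := ratio_le_base (R := R) h5 (by omega) (by omega) (by omega) (m := 15) (by norm_num) h
    norm_num at this
    linarith

theorem three_fifths_le_pay_of_fifteen {R : RotationSystem G} {d : G.Dart} (h5 : sdeg d = 5)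
    (h15 : 15 ≤ G.degree d.fst) : 3 / 5 ≤ R.pay d := by
  have hp := R.base_sub_give_le_pay d
  rw [give_eq_zero_of_degree (by omega) (by omega) (by omega),
    give_eq_zero_of_degree (by omega) (by omega) (by omega)] at hp
  have := ratio_le_base (R := R) h5 (by omega) (by omega) (by omega) (m := 15) (by norm_num) h15
  norm_num at this
  linarith

theorem half_le_pay_of_eighteen {R : RotationSystem G} {d : G.Dart} (h5 : sdeg d = 5)
    (h18 : 18 ≤ G.degree d.fst) : 1 / 2 ≤ R.pay d := by
  have := three_fifths_le_pay_of_fifteen (R := R) h5 (by omega)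
  linarith

/-- Here `(18 - 6)/18 = 2/3`: a full share on one side and half a share on the other make 1. This is
the origin of the 17 in the second star. -/
theorem one_le_pay_of_eighteen {R : RotationSystem G} {d : G.Dart} (h5 : sdeg d = 5)
    (h18 : 18 ≤ G.degree d.fst) (ht : R.IsTri d) (hs : sdeg (R.mirror.next d) ≠ 5) :
    1 ≤ R.pay d := by
  have hp := R.base_sub_give_le_pay d
  rw [give_eq_zero_of_degree (by omega) (by omega) (by omega),
    give_eq_zero_of_degree (by omega) (by omega) (by omega),
    base_eq_share h5 (by omega) (by omega) (by omega), share_eq ht hs] at hp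
  have h1 := le_ratio (m := 18) (by norm_num) h18
  norm_num at h1
  have h2 := R.mirror.half_le_share (by linarith) d
    (c := ((G.degree d.fst : ℚ) - 6) / G.degree d.fst)
  linarith

theorem not_tight_of_side {R : RotationSystem G} {d : G.Dart} (hs : sdeg (R.mirror.next d) ≠ 5) :
    ¬ R.Tight d.fst := fun h => hs (h (R.mirror.next d) (by simp)).1

/-- Two full shares of `(12 - 6)/12 = 1/2`, whence the 11 in the third star. In degree 13 the
constant 7/20 is chosen to give `11/20 + 2/20 + 7/20 = 1`. -/
theorem one_le_pay_of_twelve {R : RotationSystem G} {d : G.Dart} (h5 : sdeg d = 5)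
    (h12 : 12 ≤ G.degree d.fst) (ht : R.IsTri d) (ht' : R.mirror.IsTri d)
    (hs : sdeg (R.mirror.next d) ≠ 5) (hs' : sdeg (R.next d) ≠ 5) : 1 ≤ R.pay d := by
  have hp := R.base_sub_give_le_pay d
  rw [give_eq_zero_of_next hs', give_eq_zero_of_next hs] at hp
  by_cases h13 : G.degree d.fst = 13
  · rw [base_thirteen h5 h13 (not_tight_of_side hs), ind_pos hs, ind_pos hs',
      ind_pos ⟨hs, hs'⟩] at hp
    linarith
  · rw [base_eq_share h5 (by omega) (by omega) (by omega), share_eq ht hs,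
      share_eq ht' (by simpa using hs')] at hp
    have h1 := le_ratio (m := 12) (by norm_num) h12
    norm_num at h1
    linarith

/-- The complement of the 2/5 paid by a vertex of degree ten, whose presence as a far neighbor
(`hfar`) blocks the shift away from `d`. -/
theorem three_fifths_le_pay {R : RotationSystem G} {d : G.Dart} (h5 : sdeg d = 5)
    (h10 : 10 ≤ G.degree d.fst) (h11 : G.degree d.fst ≠ 11) (ht : R.IsTri d)
    (hs : sdeg (R.mirror.next d) ≠ 5)
    (hfar : sdeg (R.mirror.next (R.mirror.next d.symm)) = 10) : 3 / 5 ≤ R.pay d := by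
  have hp := R.base_sub_give_le_pay d
  have hg : R.give d = 0 := by
    refine give_eq_zero (fun h => h.2.2.2.2 hfar) fun h => ?_
    have := h.2.2.2.2.1
    omega
  rw [hg, give_eq_zero_of_next (R := R.mirror) hs] at hp
  by_cases h13 : G.degree d.fst = 13
  · rw [base_thirteen h5 h13 (not_tight_of_side hs), ind_pos hs] at hp
    have h2 := ind_nonneg (sdeg (R.next d) ≠ 5)
    have h3 := ind_nonneg (sdeg (R.mirror.next d) ≠ 5 ∧ sdeg (R.next d) ≠ 5)
    linarith
  · rw [base_eq_share h5 h10 h11 h13, share_eq ht hs] at hp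
    have h1 := le_ratio (m := 10) (by norm_num) h10
    norm_num at h1
    have h2 := R.mirror.half_le_share (by linarith) d
      (c := ((G.degree d.fst : ℚ) - 6) / G.degree d.fst)
    linarith

/-- Unless everything else around the receiver is paid by others, a large vertex pays a quarter. -/
theorem quarter_le_pay {R : RotationSystem G} {d : G.Dart} (h5 : sdeg d = 5)
    (h10 : 10 ≤ G.degree d.fst) (hf : ¬ R.Tight d.fst ∨ ¬ R.FarLarge d) : 1 / 4 ≤ R.pay d := by
  have hp := R.base_sub_give_le_pay d
  by_cases h : G.degree d.fst = 10
  · have h1 := two_fifths_le_pay_ten (R := R) h5 h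
    have h2 := R.mirror.give_nonneg (R.next d)
    linarith
  have hg := give_le_of_ne (R := R) h
  have hg' := give_le_of_ne (R := R.mirror) h
  by_cases h' : G.degree d.fst = 11
  · rw [give_eq_zero_of_degree (by omega) (by omega) (by omega),
      give_eq_zero_of_degree (by omega) (by omega) (by omega)] at hp
    by_cases ht : R.Tight d.fst
    · rw [base_eleven_tight h5 h' ht] at hp
      have := quarter_le_tightPay (x := 1 / 2) (y := 1 / 4) (by norm_num)
        (hf.resolve_left (not_not.2 ht))
      linarith
    · rw [base_eleven h5 h' ht] at hp
      have := ind_nonneg (R.Boosted d)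
      have := ind_nonneg (R.mirror.Boosted d)
      linarith
  by_cases h'' : G.degree d.fst = 13
  · by_cases ht : R.Tight d.fst
    · rw [base_thirteen_tight h5 h'' ht] at hp
      have := quarter_le_tightPay (x := 11 / 20) (y := 2 / 5) (by norm_num)
        (hf.resolve_left (not_not.2 ht))
      linarith
    · have := eleven_twentieths_le_base_thirteen h5 h'' ht
      linarith
  -- The crude bound 2/5 suffices, as shifts to both sides cost at most 1/10 in total.
  have := ratio_le_base (R := R) h5 h10 h' h'' (m := 10) (by norm_num) h10
  norm_num at this
  linarith

theorem pay_nonneg (R : RotationSystem G) (d : G.Dart) : 0 ≤ R.pay d := by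
  by_cases h5 : sdeg d = 5
  swap
  · exact (R.pay_eq_zero_of_ne h5).ge
  by_cases h10 : G.degree d.fst < 10
  · exact (R.pay_eq_zero_of_lt h10).ge
  push Not at h10
  by_cases hf : R.FarLarge d
  swap
  · have := quarter_le_pay h5 h10 (Or.inr hf)
    linarith
  by_cases h : R.Tight d.fst
  swap
  · have := quarter_le_pay (R := R) h5 h10 (Or.inl h)
    linarith
  by_cases h' : G.degree d.fst = 10
  · have h1 := two_fifths_le_pay_ten (R := R) h5 h'
    have h2 := R.mirror.give_nonneg (R.next d)
    linarith
  have hp := R.base_sub_give_le_pay d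
  rw [give_eq_zero_of_farLarge h' hf,
    give_eq_zero_of_farLarge h' (R.farLarge_mirror d |>.2 hf)] at hp
  have hb : 0 ≤ R.base d := by
    by_cases h11 : G.degree d.fst = 11
    · rw [base_eleven_tight h5 h11 h, tightPay, if_pos hf]
    by_cases h13 : G.degree d.fst = 13
    · rw [base_thirteen_tight h5 h13 h, tightPay, if_pos hf]
    have := ratio_le_base (R := R) h5 h10 h11 h13 (m := 10) (by norm_num) h10
    norm_num at this
    linarith
  linarith

/-- A vertex of degree at least twelve pays one half to a receiver whose two neighbors next to it
have degree different from five. -/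
theorem half_le_pay_of_sides {R : RotationSystem G} {d : G.Dart} (h5 : sdeg d = 5)
    (h12 : 12 ≤ G.degree d.fst) (hs : sdeg (R.mirror.next d.symm) ≠ 5)
    (hs' : sdeg (R.next d.symm) ≠ 5) : 1 / 2 ≤ R.pay d := by
  have hp := R.base_sub_give_le_pay d
  have hg : R.give d = 0 := by
    refine give_eq_zero (fun h => ?_) fun h => hs h.2.2.2.1
    have := h.1
    omega
  have hg' : R.mirror.give d = 0 := by
    refine give_eq_zero (fun h => ?_) fun h => hs' (by simpa using h.2.2.2.1)
    have := h.1
    omega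
  rw [hg, hg'] at hp
  by_cases h13 : G.degree d.fst = 13
  · have ht : ¬ R.Tight d.fst := by
      intro ht
      have h1 := (ht d rfl).2.2.snd_mirror_next_symm
      refine hs ?_
      unfold sdeg
      rw [h1]
      exact (ht (R.next d) (by simp)).1
    have := eleven_twentieths_le_base_thirteen h5 h13 ht
    linarith
  · have := ratio_le_base (R := R) h5 (by omega) (by omega) h13 (m := 12) (by norm_num) h12
    norm_num at this
    linarith

end Bounds

/-! ### Receivers whose corners are all triangular. -/

namespace AllTri

variable {V : Type*} {G : SimpleGraph V} {R : RotationSystem G} {h : G.Dart}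

theorem mirror (ha : R.AllTri h.fst) : R.mirror.AllTri h.fst :=
  (R.allTri_mirror _).2 ha

theorem isTri_symm (ha : R.AllTri h.fst) : R.IsTri h.symm :=
  (R.isTri_symm h).2 (ha h rfl).2

theorem mirror_isTri_symm (ha : R.AllTri h.fst) : R.mirror.IsTri h.symm :=
  (R.mirror_isTri_symm h).2 (ha h rfl).1

end AllTri

section Receivers

variable {V : Type*} [Fintype V] {G : SimpleGraph V} [DecidableRel G.Adj]

theorem sdeg_congr {d e : G.Dart} (h : d.snd = e.snd) : sdeg d = sdeg e := by
  unfold sdeg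
  rw [h]

theorem sdeg_symm (d : G.Dart) : sdeg d.symm = G.degree d.fst := rfl

theorem degree_symm_fst (d : G.Dart) : G.degree d.symm.fst = sdeg d := rfl

namespace AllTri

variable {R : RotationSystem G} {h : G.Dart}

theorem sdeg_next_symm (ha : R.AllTri h.fst) : sdeg (R.next h.symm) = sdeg (R.mirror.next h) :=
  sdeg_congr (ha h rfl).1.snd_next_symm

theorem sdeg_mirror_next_symm (ha : R.AllTri h.fst) :
    sdeg (R.mirror.next h.symm) = sdeg (R.next h) :=
  sdeg_congr (ha h rfl).2.snd_mirror_next_symm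

end AllTri

variable {R : RotationSystem G} {h : G.Dart}

/-- With only triangles around, a large neighbor next to a neighbor of degree different from five
pays a half. -/
theorem half_le_pay_of_next (h5 : G.degree h.fst = 5) (ha : R.AllTri h.fst)
    (h10 : 10 ≤ sdeg h) (hs : sdeg (R.next h) ≠ 5) : 1 / 2 ≤ R.pay h.symm := by
  have hs' : sdeg (R.mirror.next h.symm) ≠ 5 := by rwa [ha.sdeg_mirror_next_symm]
  by_cases h11 : sdeg h = 10
  · exact half_le_pay_ten h5 h11 (Or.inl hs')
  · exact half_le_pay h5 (by rw [degree_symm_fst]; omega) ha (Or.inl (not_tight_of_side hs'))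

theorem half_le_pay_of_mirror_next (h5 : G.degree h.fst = 5) (ha : R.AllTri h.fst)
    (h10 : 10 ≤ sdeg h) (hs : sdeg (R.mirror.next h) ≠ 5) : 1 / 2 ≤ R.pay h.symm := by
  rw [← pay_mirror]
  exact half_le_pay_of_next h5 ha.mirror h10 hs

/-- A receiver between vertices of degrees eleven and ten whose neighbors are of degrees
`11, 5, 10, 5` and different from five. -/
theorem one_le_pay_add_pay_eleven (S : R.Starless) (h5 : G.degree h.fst = 5)
    (ha : R.AllTri h.fst) (h11 : sdeg h = 11) (hc : sdeg (R.next h) = 5)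
    (h10 : sdeg (R.next (R.next h)) = 10) (hb : sdeg (R.mirror.next h) ≠ 5) :
    1 ≤ R.pay h.symm + R.pay (R.next (R.next h)).symm := by
  have h10' := two_fifths_le_pay_ten (R := R) (d := (R.next (R.next h)).symm)
    (by simpa [sdeg_symm] using h5) h10
  have hg0 := R.mirror.give_nonneg (R.next (R.next (R.next h)).symm)
  have hnt : ¬ R.Tight h.symm.fst :=
    not_tight_of_side (R := R.mirror) (d := h.symm) (by
      rw [mirror_mirror, ha.sdeg_next_symm]; exact hb) ∘ (R.tight_mirror _).2
  have hbase := base_eleven (R := R) (d := h.symm) h5 h11 hnt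
  have hpay := R.base_sub_give_le_pay h.symm
  have hd11 : G.degree h.symm.fst = 11 := h11
  rw [give_eq_zero_of_degree (by omega) (by omega) (by omega),
    give_eq_zero_of_degree (by omega) (by omega) (by omega), hbase] at hpay
  have hi := ind_nonneg (R.Boosted h.symm)
  have hi' := ind_nonneg (R.mirror.Boosted h.symm)
  -- The payments 1/2 and 2/5 leave 1/10 missing, which the boost at degree 11 or the shift at
  -- degree 10 provides. If both fail, the common neighbor `k.fst` is the center of a fourth star.
  by_cases hboost : R.mirror.Boosted h.symm
  · rw [ind_pos hboost] at hpay
    linarith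
  set k := (R.next h).symm with hk
  have e1 : R.mirror.next h.symm = (R.next k).symm := (ha h rfl).2.mirror_next_symm_of_mirror
  have e2 : R.next (R.next (R.next h)).symm = (R.mirror.next k).symm := by
    have := (ha (R.next (R.next h)) (by simp)).1.next_symm
    simpa using this
  by_cases hgive : R.mirror.GivesTen (R.next (R.next (R.next h)).symm)
  · have : 1 / 10 ≤ R.mirror.give (R.next (R.next (R.next h)).symm) := by
      have := ind_nonneg (R.mirror.GivesThirteen (R.next (R.next (R.next h)).symm))
      unfold give
      rw [ind_pos hgive]
      linarith
    linarith
  exfalso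
  have hkdeg : G.degree k.fst = 5 := hc
  have hD : sdeg (R.next k) = 11 := by
    have : sdeg (R.next k) = G.degree (R.mirror.next h.symm).fst := by rw [e1]; rfl
    rw [this, degree_next_fst]; exact h11
  have hE : sdeg (R.mirror.next k) = 10 := by
    have : sdeg (R.mirror.next k) = G.degree (R.next (R.next (R.next h)).symm).fst := by
      rw [e2]; rfl
    rw [this, degree_next_fst]; exact h10
  have hw : sdeg (R.next (R.next k)) = 5 := by
    by_contra hw
    apply hboost
    refine ⟨?_, ?_, ?_⟩
    · rw [mirror_mirror, ha.sdeg_next_symm]; exact hb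
    · rw [ha.sdeg_mirror_next_symm]; exact hc
    · rw [mirror_mirror]
      by_contra! hcon
      have := sdeg_congr hcon.2.snd_next_symm
      rw [hcon.1, e1] at this
      exact hw (by simpa using this)
  have hq : sdeg (R.mirror.next (R.mirror.next k)) = 5 := by
    by_contra hq
    apply hgive
    refine ⟨by rw [degree_next_fst]; exact h10, ?_, ?_, ?_, ?_⟩
    · rw [e2, sdeg_symm, degree_next_fst]; exact hkdeg
    · rw [mirror_next_next, sdeg_symm]; simpa using h5
    · rw [mirror_mirror]
      by_contra! hcon
      have := sdeg_congr hcon.2.snd_mirror_next_symm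
      rw [hcon.1, e2] at this
      exact hq (by simpa using this)
    · rw [mirror_mirror, e2, SimpleGraph.Dart.symm_symm, next_mirror_next, hD]
      norm_num
  refine S.not_star₄ (h := R.next k) (by rw [degree_next_fst]; exact hkdeg) hw.le ?_ ?_ ?_ ?_
  · rw [R.next_three hkdeg, hq]
  · rw [mirror_next_next, hE]
  · rw [mirror_next_next, hk, sdeg_symm]; simpa using h5.le
  · rw [hD]; norm_num

/-- A receiver whose neighbors are of degrees `10, 5, d, 5, 5` with `d` large. -/
theorem one_le_pay_add_pay_ten (S : R.Starless) (h5 : G.degree h.fst = 5)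
    (ha : R.AllTri h.fst) (h10 : sdeg h = 10) (hc : sdeg (R.next h) = 5)
    (hb : sdeg (R.mirror.next h) = 5) (haa : sdeg (R.mirror.next (R.mirror.next h)) = 5) :
    1 ≤ R.pay h.symm + R.pay (R.next (R.next h)).symm := by
  have hn3 := R.next_three h5
  obtain ⟨h', hh'⟩ : ∃ h', h' = R.next (R.next h) := ⟨_, rfl⟩
  rw [← hh'] at hn3 ⊢
  have hfst : h'.fst = h.fst := by simp [hh']
  have h5' : G.degree h'.fst = 5 := by rw [hfst]; exact h5
  have ha' : R.AllTri h'.fst := by rw [hfst]; exact ha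
  have hp : R.mirror.next h' = R.next h := by simp [hh']
  have hpp : R.mirror.next (R.mirror.next h') = h := by simp [hh']
  have hnn : R.next (R.next h') = R.mirror.next h := by rw [hn3]; simp
  have hnnn : R.next (R.next (R.next h')) = h := by rw [hnn]; simp
  have h13 : 13 ≤ sdeg h' := by
    by_contra hlt
    refine S.not_star₄ (h := h') h5' ?_ ?_ ?_ ?_ ?_
    · rw [hn3, haa]
    · rw [hnn, hb]
    · rw [hpp, h10]
    · rw [hp, hc]
    · omega
  have hten := two_fifths_le_pay_ten (R := R) (d := h.symm) h5 h10
  have hg0 := R.mirror.give_nonneg (R.next h.symm)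
  by_cases h15 : 15 ≤ sdeg h'
  · have := three_fifths_le_pay_of_fifteen (R := R) (d := h'.symm) h5' h15
    linarith
  have hdeg' : G.degree h'.symm.fst = sdeg h' := rfl
  have hnf : ¬ R.FarLarge h'.symm := by
    intro hf
    have := hf.1
    rw [SimpleGraph.Dart.symm_symm, hnn] at this
    omega
  have hloss : R.give h'.symm = 0 := by
    refine give_eq_zero (fun h => ?_) fun h => ?_
    · have := h.1
      omega
    · have := h.2.2.2.2.1
      rw [SimpleGraph.Dart.symm_symm, hpp] at this
      omega
  have hloss' : R.mirror.give h'.symm = 0 := by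
    refine give_eq_zero (fun h => ?_) fun h => ?_
    · have := h.1
      omega
    · rcases h.2.2.2.2.2.1 with h1 | h1
      · rw [SimpleGraph.Dart.symm_symm, mirror_mirror, hnnn] at h1
        omega
      · exact h1 (ha' _ (by simp)).2
  -- Only degrees 13 and 14 are left. With the 2/5 from degree ten, 1/20 is still missing and must
  -- come from a shift by one of the two payers.
  have hbase : 11 / 20 ≤ R.base h'.symm := by
    by_cases h13' : sdeg h' = 13
    · by_cases ht : R.Tight h'.symm.fst
      · rw [base_thirteen_tight (d := h'.symm) h5' h13' ht, tightPay_eq ha' hnf]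
      · exact eleven_twentieths_le_base_thirteen h5' h13' ht
    · have := ratio_le_base (R := R) (d := h'.symm) h5' (by omega) (by omega) (by omega) (m := 14)
        (by norm_num) (by omega)
      norm_num at this
      linarith
  have hpay : R.base h'.symm + R.give (R.mirror.next h'.symm) ≤ R.pay h'.symm := by
    have := R.mirror.give_nonneg (R.next h'.symm)
    unfold pay
    rw [hloss, hloss']
    linarith
  have hg1 := R.give_nonneg (R.mirror.next h'.symm)
  obtain ⟨k, hk⟩ : ∃ k, k = (R.mirror.next h).symm := ⟨_, rfl⟩
  have e1 : R.next h.symm = (R.mirror.next k).symm := by rw [hk]; exact (ha h rfl).1.next_symm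
  have hkdeg : G.degree k.fst = 5 := by rw [hk]; exact hb
  have e2 : R.next k = (R.mirror.next (R.next h').symm).symm := by
    rw [hk, (ha (R.mirror.next h) (by simp)).1.next_symm, ← hn3]
  have hka : sdeg (R.next k) = 5 := by
    rw [e2, sdeg_symm, degree_next_fst, hn3]; exact haa
  have hkp : sdeg (R.mirror.next k) = 10 := by
    have : sdeg (R.mirror.next k) = G.degree (R.next h.symm).fst := by rw [e1]; rfl
    rw [this, degree_next_fst]; exact h10
  by_cases hgive : R.mirror.GivesTen (R.next h.symm)
  · have : 1 / 10 ≤ R.mirror.give (R.next h.symm) := by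
      have := ind_nonneg (R.mirror.GivesThirteen (R.next h.symm))
      unfold give
      rw [ind_pos hgive]
      linarith
    linarith
  -- The only way for the vertex of degree ten to withhold its shift.
  have hz : sdeg (R.mirror.next (R.mirror.next k)) = 5 := by
    by_contra hz
    apply hgive
    refine ⟨by rw [degree_next_fst]; exact h10, ?_, ?_, ?_, ?_⟩
    · rw [ha.sdeg_next_symm, hb]
    · rw [mirror_next_next, sdeg_symm, h5]
    · rw [mirror_mirror]
      by_contra! hcon
      have := sdeg_congr hcon.2.snd_mirror_next_symm
      rw [hcon.1, e1] at this
      exact hz (by simpa using this)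
    · rw [mirror_mirror, e1, SimpleGraph.Dart.symm_symm, next_mirror_next, hka]
      norm_num
  -- All other neighbors of `k.fst` now fit the fourth star. The large vertex found here triggers
  -- the shift of 1/20 by the other payer.
  have hw : 13 ≤ sdeg (R.next (R.next k)) := by
    by_contra hlt
    refine S.mirror.not_star₄ (h := R.next (R.next k))
      (by rw [degree_next_fst, degree_next_fst]; exact hkdeg) ?_ ?_ ?_ ?_ ?_
    · rw [mirror_next_next, hka]
    · rw [mirror_next_next, mirror_next_next, hk, sdeg_symm, degree_next_fst, h5]
    · rw [mirror_mirror, R.next_three hkdeg, next_mirror_next, hkp]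
    · rw [mirror_mirror, R.next_three hkdeg, hz]
    · omega
  have hgive' : R.GivesThirteen (R.mirror.next h'.symm) := by
    obtain ⟨l, hl⟩ : ∃ l, l = (R.next h').symm := ⟨_, rfl⟩
    have e3 : (R.mirror.next h'.symm).symm = R.next l := by
      rw [(ha' h' rfl).2.mirror_next_symm_of_mirror, hl]; simp
    have e4 : sdeg (R.mirror.next l) = 5 := by
      rw [hl, sdeg_congr (ha' (R.next h') (by simp)).2.snd_mirror_next_symm, hnn, hb]
    rw [← hl] at e2
    refine ⟨?_, ?_, ?_, ?_, ?_, ?_, ?_⟩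
    · rw [degree_next_fst]; omega
    · rw [ha'.sdeg_mirror_next_symm, hn3, haa]
    · rw [next_mirror_next, sdeg_symm, h5']
    · rw [e3, mirror_next_next, hl, sdeg_symm, degree_next_fst, h5']
    · rw [e3, mirror_next_next, e4]
    · rw [e3, mirror_next_next]
      by_contra! hcon
      have := sdeg_congr hcon.2.snd_next_symm
      rw [← e2] at this
      omega
    · rw [next_mirror_next, SimpleGraph.Dart.symm_symm, hnnn, h10]
  have : 1 / 20 ≤ R.give (R.mirror.next h'.symm) := by
    have := ind_nonneg (R.GivesTen (R.mirror.next h'.symm))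
    unfold give
    rw [ind_pos hgive']
    linarith
  linarith

end Receivers

/-! ### Final charges and the contradiction. -/

section Discharging

variable {V : Type*} [Fintype V] {G : SimpleGraph V} [DecidableRel G.Adj]
  {R : RotationSystem G} {h : G.Dart}

theorem next_next_ne_of_five (h5 : G.degree h.fst = 5) : R.next (R.next h) ≠ h := by
  intro e
  have := (R.iterate_next_eq_self h 2).1 (by simpa [pow_succ] using e)
  rw [h5] at this
  omega

theorem pay_le_sum (w : V) (hw : h.fst = w) :
    R.pay h.symm ≤ ∑ d ∈ out G w, R.pay d.symm := by
  have key : ∀ d ∈ out G w, 0 ≤ R.pay d.symm := fun d _ => R.pay_nonneg d.symm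
  exact single_le_sum key (mem_out.2 hw)

theorem pay_add_pay_le_sum (w : V) (hw : h.fst = w) {h' : G.Dart} (hw' : h'.fst = w)
    (hne : h ≠ h') : R.pay h.symm + R.pay h'.symm ≤ ∑ d ∈ out G w, R.pay d.symm := by
  classical
  rw [← sum_pair (f := fun d => R.pay d.symm) hne]
  refine sum_le_sum_of_subset_of_nonneg ?_ fun d _ _ => R.pay_nonneg _
  intro e he
  simp only [mem_insert, mem_singleton] at he
  rcases he with rfl | rfl
  exacts [mem_out.2 hw, mem_out.2 hw']

theorem Starless.exists_large (S : R.Starless) {w : V} (h5 : G.degree w = 5) :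
    ∃ h : G.Dart, h.fst = w ∧ 10 ≤ sdeg h := by
  obtain ⟨h, hw⟩ : (out G w).Nonempty := by
    rw [← card_pos, card_out, h5]
    norm_num
  rw [mem_out] at hw
  subst hw
  by_contra! hcon
  have key : ∀ e : G.Dart, e.fst = h.fst → sdeg e ≤ 6 := fun e he =>
    (S.gap _).resolve_right (not_le.2 (hcon e he))
  refine S.not_star₃ h5 (key _ ?_) (key _ ?_) (key _ ?_) (key _ ?_) ?_
  any_goals simp
  exact (key h rfl).trans (by norm_num)

/-- The neighbor of degree other than 5 beside `h` entitles `h` to at least 1/2. This matches a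
partner of degree above ten; a partner of degree ten needs 3/5, which only degree 11 can fail to pay
directly. -/
theorem one_le_pay_add_pay_of_side (S : R.Starless) (h5 : G.degree h.fst = 5)
    (ha : R.AllTri h.fst) (h10 : 10 ≤ sdeg h) (h10' : 10 ≤ sdeg (R.next (R.next h)))
    (hc : sdeg (R.next h) = 5) (hb : sdeg (R.mirror.next h) ≠ 5)
    (hb' : sdeg (R.mirror.next h) < 10) :
    1 ≤ R.pay h.symm + R.pay (R.next (R.next h)).symm := by
  have h5' : sdeg (R.next (R.next h)).symm = 5 := by
    rw [sdeg_symm, degree_next_fst, degree_next_fst, h5]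
  have hhalf := half_le_pay_of_mirror_next h5 ha h10 hb
  by_cases hten : sdeg (R.next (R.next h)) = 10
  · by_cases h11 : sdeg h = 11
    · exact one_le_pay_add_pay_eleven S h5 ha h11 hc hten hb
    · have h1 : 3 / 5 ≤ R.mirror.pay h.symm := by
        refine three_fifths_le_pay h5 h10 h11 ha.mirror_isTri_symm ?_ ?_
        · rw [mirror_mirror, ha.sdeg_next_symm]; exact hb
        · rw [mirror_mirror]; exact hten
      rw [pay_mirror] at h1
      have h2 := two_fifths_le_pay_ten (R := R) h5' hten
      have h3 := R.mirror.give_nonneg (R.next (R.next (R.next h)).symm)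
      linarith
  · have h1 : 1 / 2 ≤ R.pay (R.next (R.next h)).symm := by
      refine half_le_pay h5' (by rw [degree_symm_fst]; omega) ?_ (Or.inr ?_)
      · have : (R.next (R.next h)).symm.snd = h.fst := by simp
        rw [this]; exact ha
      · rintro ⟨h1, -⟩
        rw [SimpleGraph.Dart.symm_symm, R.next_three h5, next_mirror_next] at h1
        omega
    linarith

theorem one_le_pay_add_pay (S : R.Starless) (h5 : G.degree h.fst = 5)
    (ha : R.AllTri h.fst) (h10 : 10 ≤ sdeg h) (h10' : 10 ≤ sdeg (R.next (R.next h)))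
    (ha' : sdeg (R.mirror.next (R.mirror.next h)) < 10)
    (hb' : sdeg (R.mirror.next h) < 10) :
    1 ≤ R.pay h.symm + R.pay (R.next (R.next h)).symm := by
  obtain ⟨h', hh'⟩ : ∃ h', h' = R.next (R.next h) := ⟨_, rfl⟩
  have hfst : h'.fst = h.fst := by simp [hh']
  have h5' : G.degree h'.fst = 5 := by rw [hfst]; exact h5
  have haa : R.AllTri h'.fst := by rw [hfst]; exact ha
  have hp : R.mirror.next h' = R.next h := by simp [hh']
  have hpp : R.mirror.next (R.mirror.next h') = h := by simp [hh']
  have hn : R.next h' = R.mirror.next (R.mirror.next h) := by rw [hh', R.next_three h5]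
  have hnn : R.next (R.next h') = R.mirror.next h := by rw [hn]; simp
  rw [← hh'] at h10' ⊢
  by_cases hc : sdeg (R.next h) = 5
  swap
  · have h1 := half_le_pay_of_next h5 ha h10 hc
    have h2 := half_le_pay_of_mirror_next h5' haa h10' (by rwa [hp])
    linarith
  by_cases hb : sdeg (R.mirror.next h) = 5
  swap
  · have := one_le_pay_add_pay_of_side S h5 ha h10 (hh' ▸ h10') hc hb hb'
    rwa [← hh'] at this
  by_cases hA : sdeg (R.mirror.next (R.mirror.next h)) = 5
  swap
  · have := one_le_pay_add_pay_of_side S.mirror h5' haa.mirror h10' (by rwa [hpp]) (by rwa [hp])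
      (by rwa [mirror_mirror, hn]) (by rwa [mirror_mirror, hn])
    rw [pay_mirror, pay_mirror, hpp] at this
    linarith
  by_cases hten : sdeg h = 10
  · have := one_le_pay_add_pay_ten S h5 ha hten hc hb hA
    rwa [← hh'] at this
  by_cases hten' : sdeg h' = 10
  · have := one_le_pay_add_pay_ten S.mirror h5' haa.mirror hten' (by rwa [hp])
      (by rwa [mirror_mirror, hn]) (by rwa [mirror_mirror, hnn])
    rw [pay_mirror, pay_mirror, hpp] at this
    linarith
  have h1 : 1 / 2 ≤ R.pay h.symm := by
    refine half_le_pay h5 (by rw [degree_symm_fst]; omega) ha (Or.inr ?_)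
    rintro ⟨-, h2⟩
    rw [SimpleGraph.Dart.symm_symm] at h2
    omega
  have h2 : 1 / 2 ≤ R.pay h'.symm := by
    refine half_le_pay h5' (by rw [degree_symm_fst]; omega) haa (Or.inr ?_)
    rintro ⟨h2, -⟩
    rw [SimpleGraph.Dart.symm_symm, hnn] at h2
    omega
  linarith

/-- A vertex of degree five all of whose corners are triangular receives enough. -/
theorem one_le_sum_pay (S : R.Starless) {w : V} (h5 : G.degree w = 5) (ha : R.AllTri w) :
    1 ≤ ∑ d ∈ out G w, R.pay d.symm := by
  -- Adjacent large neighbors are each other's side of degree other than 5, so each pays 1/2.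
  by_cases hadj : ∃ h : G.Dart, h.fst = w ∧ 10 ≤ sdeg h ∧ 10 ≤ sdeg (R.next h)
  · obtain ⟨h, rfl, h1, h2⟩ := hadj
    have hp1 := half_le_pay_of_next h5 ha h1 (by omega)
    have hp2 := half_le_pay_of_mirror_next (R := R) (h := R.next h) (by rw [degree_next_fst, h5])
      (by rwa [next_fst]) h2 (by rw [mirror_next_next]; omega)
    have := pay_add_pay_le_sum (R := R) h.fst rfl (R.next_fst h) (R.next_ne h5.ge).symm
    linarith
  push Not at hadj
  by_cases htwo : ∃ h : G.Dart, h.fst = w ∧ 10 ≤ sdeg h ∧ 10 ≤ sdeg (R.next (R.next h))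
  · obtain ⟨h, rfl, h1, h2⟩ := htwo
    have hp := one_le_pay_add_pay S h5 ha h1 h2
      (by rw [← R.next_three h5]; exact hadj _ (by simp) h2)
      (by
        by_contra! h3
        have := hadj _ (by simp) h3
        rw [next_mirror_next] at this
        omega)
    have := pay_add_pay_le_sum (R := R) h.fst rfl (h' := R.next (R.next h)) (by simp)
      (next_next_ne_of_five h5).symm
    linarith
  push Not at htwo
  -- With a single large neighbor, the number of sides of degree 5 decides which of the first three
  -- stars applies.
  obtain ⟨h, rfl, h10⟩ := S.exists_large h5
  refine le_trans ?_ (pay_le_sum h.fst rfl)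
  have small : ∀ e : G.Dart, sdeg e < 10 → sdeg e ≤ 6 := fun e he =>
    (S.gap _).resolve_right (not_le.2 he)
  have s1 := small _ (hadj h rfl h10)
  have s2 := small _ (htwo h rfl h10)
  have s3 : sdeg (R.mirror.next (R.mirror.next h)) ≤ 6 := by
    refine small _ ?_
    by_contra! h3
    have := htwo _ (by simp) h3
    rw [next_mirror_next, next_mirror_next] at this
    omega
  have s4 : sdeg (R.mirror.next h) ≤ 6 := by
    refine small _ ?_
    by_contra! h3
    have := hadj _ (by simp) h3
    rw [next_mirror_next] at this
    omega
  by_cases e1 : sdeg (R.next h) = 5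
  · by_cases e4 : sdeg (R.mirror.next h) = 5
    · exact (S.not_star₁ h5 e1.le s2 s3 e4.le).elim
    · have h18 : 18 ≤ sdeg h := by
        by_contra hlt
        exact S.not_star₂ h5 e1.le s2 s3 s4 (by omega)
      rw [← pay_mirror]
      refine one_le_pay_of_eighteen h5 h18 ha.mirror_isTri_symm ?_
      rwa [mirror_mirror, ha.sdeg_next_symm]
  · by_cases e4 : sdeg (R.mirror.next h) = 5
    · have h18 : 18 ≤ sdeg h := by
        by_contra hlt
        exact S.mirror.not_star₂ h5 e4.le s3 (by rwa [mirror_mirror]) (by rwa [mirror_mirror])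
          (by omega)
      refine one_le_pay_of_eighteen h5 h18 ha.isTri_symm ?_
      rwa [ha.sdeg_mirror_next_symm]
    · have h12 : 12 ≤ sdeg h := by
        by_contra hlt
        exact S.not_star₃ h5 s1 s2 s3 s4 (by omega)
      refine one_le_pay_of_twelve h5 h12 ha.isTri_symm ha.mirror_isTri_symm ?_ ?_
      · rwa [ha.sdeg_mirror_next_symm]
      · rwa [ha.sdeg_next_symm]

/-- If a tight neighbor of a vertex of degree five may pay nothing, then two others pay a half. -/
theorem half_le_sum_pay_of_tight (h5 : G.degree h.fst = 5) (ht : R.Tight h.symm.fst)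
    (hf : R.FarLarge h.symm) : 1 / 2 ≤ ∑ d ∈ out G h.fst, R.pay d.symm := by
  obtain ⟨-, t1, t2⟩ := ht h.symm rfl
  have s1 : sdeg (R.mirror.next h) = 5 := by
    have := sdeg_congr t2.snd_mirror_next_symm
    rw [SimpleGraph.Dart.symm_symm] at this
    rw [this]
    exact (ht _ (by simp)).1
  have s2 : sdeg (R.next h) = 5 := by
    have := sdeg_congr t1.snd_next_symm
    rw [SimpleGraph.Dart.symm_symm] at this
    rw [this]
    exact (ht _ (by simp)).1
  obtain ⟨f1, f2⟩ := hf
  rw [SimpleGraph.Dart.symm_symm] at f1 f2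
  have h3 := R.next_three h5
  -- Each far neighbor has, among its own far neighbors around `h.fst`, a vertex of degree 5
  -- adjacent to the tight one, so `FarLarge` fails for it.
  have p1 : 1 / 4 ≤ R.pay (R.next (R.next h)).symm := by
    refine quarter_le_pay ?_ f1 (Or.inr ?_)
    · rw [sdeg_symm, degree_next_fst, degree_next_fst, h5]
    · rintro ⟨g1, -⟩
      rw [SimpleGraph.Dart.symm_symm, h3, next_mirror_next] at g1
      omega
  have p2 : 1 / 4 ≤ R.pay (R.mirror.next (R.mirror.next h)).symm := by
    refine quarter_le_pay ?_ f2 (Or.inr ?_)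
    · rw [sdeg_symm, degree_next_fst, degree_next_fst, h5]
    · rintro ⟨-, g2⟩
      rw [SimpleGraph.Dart.symm_symm, ← h3, mirror_next_next, mirror_next_next] at g2
      omega
  have hne : R.next (R.next h) ≠ R.mirror.next (R.mirror.next h) := by
    rw [← h3]
    exact (R.next_ne (by rw [degree_next_fst, degree_next_fst, h5])).symm
  have := pay_add_pay_le_sum (R := R) h.fst (h := R.next (R.next h))
    (h' := R.mirror.next (R.mirror.next h)) (by simp) (by simp) hne
  linarith

/-- A vertex of degree five receives at least a half. -/
theorem half_le_sum_pay (S : R.Starless) {w : V} (h5 : G.degree w = 5) :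
    1 / 2 ≤ ∑ d ∈ out G w, R.pay d.symm := by
  by_cases hz : ∃ h : G.Dart, h.fst = w ∧ R.Tight h.symm.fst ∧ R.FarLarge h.symm
  · obtain ⟨h, rfl, ht, hf⟩ := hz
    exact half_le_sum_pay_of_tight h5 ht hf
  push Not at hz
  have quarter : ∀ h : G.Dart, h.fst = w → 10 ≤ sdeg h → 1 / 4 ≤ R.pay h.symm := by
    intro h hw h10
    refine quarter_le_pay (by rw [sdeg_symm, hw, h5]) h10 ?_
    by_cases ht : R.Tight h.symm.fst
    · exact Or.inr (hz h hw ht)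
    · exact Or.inl ht
  obtain ⟨h, rfl, h10⟩ := S.exists_large h5
  by_cases htwo : ∃ h' : G.Dart, h'.fst = h.fst ∧ h ≠ h' ∧ 10 ≤ sdeg h'
  · obtain ⟨h', hw, hne, h10'⟩ := htwo
    have h1 := quarter h rfl h10
    have h2 := quarter h' hw h10'
    have := pay_add_pay_le_sum (R := R) h.fst rfl hw hne
    linarith
  push Not at htwo
  refine le_trans ?_ (pay_le_sum h.fst rfl)
  have small : ∀ e : G.Dart, e.fst = h.fst → h ≠ e → sdeg e ≤ 6 := fun e he hne =>
    (S.gap _).resolve_right (not_le.2 (htwo e he hne))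
  have s1 := small (R.next h) (by simp) (R.next_ne h5.ge).symm
  have s2 := small (R.next (R.next h)) (by simp) (next_next_ne_of_five h5).symm
  have s3 := small (R.mirror.next (R.mirror.next h)) (by simp)
    (next_next_ne_of_five h5).symm
  have s4 := small (R.mirror.next h) (by simp) (R.mirror.next_ne h5.ge).symm
  by_cases e1 : sdeg (R.next h) = 5
  · refine half_le_pay_of_eighteen h5 ?_
    rw [degree_symm_fst]
    by_contra hlt
    exact S.not_star₂ h5 e1.le s2 s3 s4 (by omega)
  · by_cases e4 : sdeg (R.mirror.next h) = 5
    · refine half_le_pay_of_eighteen h5 ?_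
      rw [degree_symm_fst]
      by_contra hlt
      exact S.mirror.not_star₂ h5 e4.le s3 (by rwa [mirror_mirror]) (by rwa [mirror_mirror])
        (by omega)
    · refine half_le_pay_of_sides h5 ?_ e4 e1
      rw [degree_symm_fst]
      by_contra hlt
      exact S.not_star₃ h5 s1 s2 s3 s4 (by omega)

theorem half_le_sum_cornerCharge {w : V} (h : ¬ R.AllTri w) :
    1 / 2 ≤ ∑ d ∈ out G w, R.cornerCharge d := by
  rw [sum_cornerCharge_out]
  have : 1 ≤ ∑ d ∈ out G w, ind (¬ R.IsTri d) := by
    unfold AllTri at h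
    push Not at h
    obtain ⟨d, hd, h⟩ := h
    by_cases ht : R.IsTri d
    · exact one_le_sum_ind (fun d => ¬ R.IsTri d) (d := R.next d) (by simpa using hd)
        (fun h' => h ht ((R.mirror_isTri d).2 h'))
    · exact one_le_sum_ind (fun d => ¬ R.IsTri d) hd ht
  linarith

theorem final_charge_nonneg (S : R.Starless) (v : V) :
    0 ≤ ((G.degree v : ℚ) - 6) + ∑ d ∈ out G v, R.cornerCharge d - ∑ d ∈ out G v, R.pay d
      + ∑ d ∈ out G v, R.pay d.symm := by
  have hin : 0 ≤ ∑ d ∈ out G v, R.pay d.symm := sum_nonneg fun d _ => R.pay_nonneg _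
  have hcc : 0 ≤ ∑ d ∈ out G v, R.cornerCharge d :=
    sum_nonneg fun d _ => R.cornerCharge_nonneg d
  rcases S.gap v with h | h
  · have hout : ∑ d ∈ out G v, R.pay d = 0 := by
      refine sum_eq_zero fun d hd => R.pay_eq_zero_of_lt ?_
      rw [mem_out.1 hd]
      omega
    rw [hout]
    have h5 := S.five_le v
    rcases h5.eq_or_lt with h5 | h5
    · rw [← h5]
      norm_num
      by_cases ha : R.AllTri v
      · have := one_le_sum_pay S h5.symm ha
        linarith
      · have := half_le_sum_pay S h5.symm
        have := half_le_sum_cornerCharge ha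
        linarith
    · have : (6 : ℚ) ≤ G.degree v := by exact_mod_cast h5
      linarith
  · have := sum_base_le S h
    rw [sum_pay]
    linarith

theorem sum_out (f : G.Dart → ℚ) : ∑ v : V, ∑ d ∈ out G v, f d = ∑ d : G.Dart, f d := by
  classical
  rw [← sum_fiberwise univ (fun d : G.Dart => d.fst) f]
  refine sum_congr rfl fun v _ => sum_congr ?_ fun _ _ => rfl
  ext d
  simp [mem_out]

/-- Reversing darts matches every payment made with one received, so the total stays negative
although every final charge is non-negative. -/
theorem not_starless (hplane : R.IsPlane) [Nonempty V] : ¬ R.Starless := by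
  intro S
  have hneg := R.sum_charge_neg hplane S.five_le
  have hpos : 0 ≤ ∑ v : V, (((G.degree v : ℚ) - 6) + ∑ d ∈ out G v, R.cornerCharge d
      - ∑ d ∈ out G v, R.pay d + ∑ d ∈ out G v, R.pay d.symm) :=
    sum_nonneg fun v _ => final_charge_nonneg S v
  have hsymm : ∑ d : G.Dart, R.pay d.symm = ∑ d : G.Dart, R.pay d :=
    Equiv.sum_comp (reverse G) R.pay
  rw [sum_add_distrib, sum_sub_distrib, sum_add_distrib, sum_out, sum_out, sum_out, hsymm] at hpos
  linarith

end Discharging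

end RotationSystem

theorem theorem9 {V : Type*} [Fintype V] (G : SimpleGraph V) [DecidableRel G.Adj]
    (R : RotationSystem G) (hplane : R.IsPlane) (hmin : G.minDegree = 5)
    (hdeg : ∀ v : V, G.degree v ∉ Set.Icc 7 9) :
    R.HasStar ![5, 6, 6, 5, ⊤] ∨ R.HasStar ![5, 6, 6, 6, 17] ∨
      R.HasStar ![6, 6, 6, 6, 11] ∨ R.HasStar ![5, 5, 10, 5, 12] := by
  by_contra hcon
  push Not at hcon
  obtain ⟨h1, h2, h3, h4⟩ := hcon
  -- On an empty vertex type `minDegree` takes the default value 0, not 5.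
  have hne : Nonempty V := by
    by_contra h
    rw [not_nonempty_iff] at h
    rw [SimpleGraph.minDegree_of_subsingleton] at hmin
    omega
  refine RotationSystem.not_starless hplane ⟨fun v => hmin ▸ G.minDegree_le_degree v, ?_,
    h1, h2, h3, h4⟩
  intro v
  have := hdeg v
  rw [Set.mem_Icc] at this
  omega
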